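/- Let $R\to S$ be a homomorphism of associative unital rings, not necessarily commutative. Modules are left modules, $R^\circ$ is the opposite ring, and $R^\circ$-modules are right $R$-modules. Assume that the flat dimension of $S$ as a left $R$-module, $\mathrm{fd}_R\,S$, and the flat dimension of $S$ as a right $R$-module, $\mathrm{fd}_{R^\circ}S$, are both finite. Then for every (possibly unbounded) complex $M$ of left $R$-modules one has $$\mathrm{Gfd}_S(S\otimes^{\mathbf L}_R M)\;\le\;\mathrm{Gfd}_R\,M .$$ Here the Gorenstein flat dimension is defined, over any ring $A$, as follows. A complex $T$ of flat $A$-modules is totally acyclic if it is acyclic and $I\otimes_A T$ is acyclic for every injective $A^\circ$-module $I$. An $A$-complex $F$ is semi-flat if each module $F_i$ is flat and the functor $-\otimes_A F$ preserves quasi-isomorphisms. For an $A$-complex $M$ (in homological grading), $$\mathrm{Gfd}_A\,M=\inf\{g\in\mathbb Z\mid T_{\ge g}\cong F_{\ge g}\text{ for some totally acyclic complex }T\text{ of flat }A\text{-modules and some semi-flat }A\text{-complex }F\text{ isomorphic to }M\text{ in the derived category}\},$$ where $X_{\ge g}$ is the quotient complex of $X$ that agrees with $X$ in degrees $\ge g$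 and vanishes in degrees $<g$; the infimum is taken in $\mathbb Z\cup\{\pm\infty\}$, so $\inf\varnothing=\infty$. The derived tensor product $S\otimes^{\mathbf L}_R M$ is the $S$-complex $S\otimes_R P$, where $P\to M$ is a semi-projective resolution. -/

import Mathlib

open CategoryTheory Limits ZeroObject TensorProduct MulOpposite

universe u

namespace GorFlat

section Tensor

variable (R : Type u) [Ring R]

/-- The subgroup of `X ⊗_ℤ M` generated by all `x r ⊗ m - x ⊗ r m`. -/
def balancedSubgroup (X M : Type u) [AddCommGroup X] [Module Rᵐᵒᵖ X]
    [AddCommGroup M] [Module R M] : AddSubgroup (X ⊗[ℤ] M) :=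
  AddSubgroup.closure
    {t | ∃ (x : X) (r : R) (m : M), t = (op r • x) ⊗ₜ[ℤ] m - x ⊗ₜ[ℤ] (r • m)}

/-- The tensor product `X ⊗_R M` of a right `R`-module `X` (a module over the opposite ring)
and a left `R`-module `M`, as an abelian group; `R` need not be commutative. -/
abbrev BalancedTensor (X M : Type u) [AddCommGroup X] [Module Rᵐᵒᵖ X]
    [AddCommGroup M] [Module R M] : Type u :=
  (X ⊗[ℤ] M) ⧸ balancedSubgroup R X M

/-- The additive map `φ ⊗_R ψ`. -/
noncomputable def balancedMap {X X' M M' : Type u} [AddCommGroup X] [Module Rᵐᵒᵖ X]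
    [AddCommGroup X'] [Module Rᵐᵒᵖ X'] [AddCommGroup M] [Module R M] [AddCommGroup M']
    [Module R M'] (φ : X →ₗ[Rᵐᵒᵖ] X') (ψ : M →ₗ[R] M') :
    BalancedTensor R X M →+ BalancedTensor R X' M' :=
  QuotientAddGroup.map _ _
    (TensorProduct.map φ.toAddMonoidHom.toIntLinearMap
      ψ.toAddMonoidHom.toIntLinearMap).toAddMonoidHom (by
      rw [balancedSubgroup, AddSubgroup.closure_le]
      rintro _ ⟨x, r, m, rfl⟩
      exact AddSubgroup.subset_closure ⟨φ x, r, ψ m, by simp⟩)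

variable {R} in
lemma balancedTensor_ext {X M : Type u} [AddCommGroup X] [Module Rᵐᵒᵖ X]
    [AddCommGroup M] [Module R M] {A : Type u} [AddCommGroup A]
    {f g : BalancedTensor R X M →+ A}
    (h : ∀ (x : X) (m : M), f (QuotientAddGroup.mk (x ⊗ₜ[ℤ] m)) =
      g (QuotientAddGroup.mk (x ⊗ₜ[ℤ] m))) :
    f = g := by
  apply QuotientAddGroup.addMonoidHom_ext
  ext t
  induction t using TensorProduct.induction_on with
  | zero => simp
  | tmul x m => exact h x m
  | add a b ha hb => rw [map_add, map_add, ha, hb]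

/-- The bifunctor `(X, M) ↦ X ⊗_R M` from right and left `R`-modules to abelian groups. -/
noncomputable def tensorBifunctor :
    ModuleCat.{u} Rᵐᵒᵖ ⥤ ModuleCat.{u} R ⥤ AddCommGrpCat.{u} where
  obj X :=
    { obj M := AddCommGrpCat.of (BalancedTensor R X M)
      map ψ := AddCommGrpCat.ofHom (balancedMap R LinearMap.id ψ.hom)
      map_id M := AddCommGrpCat.hom_ext (balancedTensor_ext (X := X) (M := M) fun _ _ ↦ rfl)
      map_comp {M _ _} _ _ :=
        AddCommGrpCat.hom_ext (balancedTensor_ext (X := X) (M := M) fun _ _ ↦ rfl) }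
  map {X _} φ :=
    { app M := AddCommGrpCat.ofHom (balancedMap R φ.hom LinearMap.id)
      naturality M _ _ :=
        AddCommGrpCat.hom_ext (balancedTensor_ext (X := X) (M := M) fun _ _ ↦ rfl) }
  map_id X := by
    ext1; funext M
    exact AddCommGrpCat.hom_ext (balancedTensor_ext (X := X) (M := M) fun _ _ ↦ rfl)
  map_comp {X _ _} _ _ := by
    ext1; funext M
    exact AddCommGrpCat.hom_ext (balancedTensor_ext (X := X) (M := M) fun _ _ ↦ rfl)

instance (X : ModuleCat.{u} Rᵐᵒᵖ) : ((tensorBifunctor R).obj X).Additive where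
  map_add {M _ f g} := AddCommGrpCat.hom_ext (balancedTensor_ext (X := X) (M := M) fun x m ↦ by
    change QuotientAddGroup.mk (x ⊗ₜ (f.hom m + g.hom m)) =
      (QuotientAddGroup.mk (x ⊗ₜ f.hom m) + QuotientAddGroup.mk (x ⊗ₜ g.hom m) :
        BalancedTensor R X _)
    rw [TensorProduct.tmul_add, QuotientAddGroup.mk_add])

instance : (tensorBifunctor R).Additive where
  map_add {X Y f g} := by
    ext1; funext M
    refine AddCommGrpCat.hom_ext (balancedTensor_ext (X := X) (M := M) fun x m ↦ ?_)
    change QuotientAddGroup.mk ((f.hom x + g.hom x) ⊗ₜ m) =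
      (QuotientAddGroup.mk (f.hom x ⊗ₜ m) + QuotientAddGroup.mk (g.hom x ⊗ₜ m) :
        BalancedTensor R Y M)
    rw [TensorProduct.add_tmul, QuotientAddGroup.mk_add]

variable {R}

/-- A left `R`-module `M` is flat if `- ⊗_R M` preserves monomorphisms. -/
def IsFlat (M : ModuleCat.{u} R) : Prop :=
  ∀ ⦃X Y : ModuleCat.{u} Rᵐᵒᵖ⦄ (φ : X ⟶ Y), Mono φ → Mono (((tensorBifunctor R).map φ).app M)

/-- `fd_R M ≤ n`: there is an exact sequence `0 → Fₙ → ⋯ → F₀ → M → 0` with all `Fᵢ` flat,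
given here through its successive kernels. -/
def HasFlatDimLE : ℕ → ModuleCat.{u} R → Prop
  | 0, M => IsFlat M
  | n + 1, M => ∃ (K F : ModuleCat.{u} R) (i : K ⟶ F) (p : F ⟶ M) (w : i ≫ p = 0),
      (ShortComplex.mk i p w).ShortExact ∧ IsFlat F ∧ HasFlatDimLE n K

/-- The flat dimension of the `R`-module `M` is finite. -/
def HasFiniteFlatDim (M : ModuleCat.{u} R) : Prop := ∃ n : ℕ, HasFlatDimLE n M

end Tensor

section ExtendScalars

variable {R S : Type u} [Ring R] [Ring S] (f : R →+* S)

/-- The `S`-submodule of `S ⊗_ℤ M` generated by all `s f(r) ⊗ m - s ⊗ r m`. -/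
def extendRel (M : Type u) [AddCommGroup M] [Module R M] : Submodule S (S ⊗[ℤ] M) :=
  Submodule.span S {t | ∃ (s : S) (r : R) (m : M), t = (s * f r) ⊗ₜ[ℤ] m - s ⊗ₜ[ℤ] (r • m)}

/-- The left `S`-module `S ⊗_R M`, for a homomorphism `f : R → S` of arbitrary rings. -/
abbrev ExtendScalars (M : Type u) [AddCommGroup M] [Module R M] : Type u :=
  (S ⊗[ℤ] M) ⧸ extendRel f M

/-- The `S`-linear map `S ⊗_R ψ`. -/
noncomputable def extendMap {M M' : Type u} [AddCommGroup M] [Module R M] [AddCommGroup M']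
    [Module R M'] (ψ : M →ₗ[R] M') : ExtendScalars f M →ₗ[S] ExtendScalars f M' :=
  Submodule.mapQ _ _
    (TensorProduct.AlgebraTensorModule.map LinearMap.id ψ.toAddMonoidHom.toIntLinearMap) (by
      rw [extendRel, Submodule.span_le]
      rintro _ ⟨s, r, m, rfl⟩
      exact Submodule.subset_span ⟨s, r, ψ m, by simp⟩)

variable {f} in
lemma extendScalars_ext {M : Type u} [AddCommGroup M] [Module R M] {A : Type u} [AddCommGroup A]
    [Module S A] {g h : ExtendScalars f M →ₗ[S] A}
    (H : ∀ s m, g (Submodule.Quotient.mk (s ⊗ₜ m)) = h (Submodule.Quotient.mk (s ⊗ₜ m))) :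
    g = h := by
  apply Submodule.linearMap_qext
  exact TensorProduct.AlgebraTensorModule.ext H

/-- The functor `M ↦ S ⊗_R M` from left `R`-modules to left `S`-modules. -/
noncomputable def extendScalarsFunctor : ModuleCat.{u} R ⥤ ModuleCat.{u} S where
  obj M := ModuleCat.of S (ExtendScalars f M)
  map ψ := ModuleCat.ofHom (extendMap f ψ.hom)
  map_id M := ModuleCat.hom_ext (extendScalars_ext (M := M) fun _ _ ↦ rfl)
  map_comp {M _ _} _ _ := ModuleCat.hom_ext (extendScalars_ext (M := M) fun _ _ ↦ rfl)

instance : (extendScalarsFunctor f).Additive where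
  map_add {M N g h} := ModuleCat.hom_ext (extendScalars_ext (M := M) fun s m ↦ by
    change Submodule.Quotient.mk (s ⊗ₜ (g.hom m + h.hom m)) =
      (Submodule.Quotient.mk (s ⊗ₜ g.hom m) + Submodule.Quotient.mk (s ⊗ₜ h.hom m) :
        ExtendScalars f N)
    rw [TensorProduct.tmul_add, Submodule.Quotient.mk_add])

end ExtendScalars

section Complexes

/-!
An `R`-complex is a cochain complex of left `R`-modules indexed by `ℤ`; the module in homological
degree `i` is `M.X (-i)`.
-/

variable {R : Type u} [Ring R]

/-- The tensor product `X ⊗_R M` (total complex with direct sums) of a complex of right and a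
complex of left `R`-modules. -/
noncomputable abbrev tensorComplex (X : CochainComplex (ModuleCat.{u} Rᵐᵒᵖ) ℤ)
    (M : CochainComplex (ModuleCat.{u} R) ℤ) : CochainComplex AddCommGrpCat.{u} ℤ :=
  HomologicalComplex.mapBifunctor X M (tensorBifunctor R) (ComplexShape.up ℤ)

/-- The morphism `φ ⊗_R M`. -/
noncomputable abbrev tensorComplexMap {X Y : CochainComplex (ModuleCat.{u} Rᵐᵒᵖ) ℤ} (φ : X ⟶ Y)
    (M : CochainComplex (ModuleCat.{u} R) ℤ) : tensorComplex X M ⟶ tensorComplex Y M :=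
  HomologicalComplex.mapBifunctorMap φ (𝟙 M) (tensorBifunctor R) (ComplexShape.up ℤ)

/-- A complex `F` is semi-flat if its modules are flat and `- ⊗_R F` preserves
quasi-isomorphisms. -/
structure IsSemiFlat (F : CochainComplex (ModuleCat.{u} R) ℤ) : Prop where
  flat (i : ℤ) : IsFlat (F.X i)
  quasiIso {X Y : CochainComplex (ModuleCat.{u} Rᵐᵒᵖ) ℤ} (φ : X ⟶ Y) :
    QuasiIso φ → QuasiIso (tensorComplexMap φ F)

/-- A complex `P` is semi-projective if its modules are projective and `Hom(P, -)` preserves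
quasi-isomorphisms; equivalently `Hom(P, -)` preserves acyclicity, which (by shifting the target)
says that every morphism from `P` to an acyclic complex is null-homotopic. -/
structure IsSemiProjective (P : CochainComplex (ModuleCat.{u} R) ℤ) : Prop where
  projective (i : ℤ) : Projective (P.X i)
  isKProjective : P.IsKProjective

/-- A totally acyclic complex of flat modules: `T` and `I ⊗_R T`, for every injective right
`R`-module `I`, are acyclic. -/
structure IsTotallyAcyclicFlat (T : CochainComplex (ModuleCat.{u} R) ℤ) : Prop where
  flat (i : ℤ) : IsFlat (T.X i)
  acyclic : T.Acyclic
  tensor_acyclic (I : ModuleCat.{u} Rᵐᵒᵖ) : Injective I →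
    ((((tensorBifunctor R).obj I).mapHomologicalComplex (ComplexShape.up ℤ)).obj T).Acyclic

/-- `F ≃ M`: the complexes are isomorphic in the derived category. -/
def DerivedIso (F M : CochainComplex (ModuleCat.{u} R) ℤ) : Prop :=
  letI := HasDerivedCategory.standard (ModuleCat.{u} R)
  Nonempty (DerivedCategory.Q.obj F ≅ DerivedCategory.Q.obj M)

/-- The quotient complex `M_{≥ g}`, written as a complex indexed by `ℕ`: the module in degree `n`
is the one of `M` in homological degree `g + n`, that is, `M.X (-g - n)`. -/
noncomputable abbrev truncGE (M : CochainComplex (ModuleCat.{u} R) ℤ) (g : ℤ) :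
    ChainComplex (ModuleCat.{u} R) ℕ :=
  M.restriction (ComplexShape.embeddingUpIntLE (-g))

/-- `(T, F)` is a Tate flat resolution of `M` with `T_{≥ g} ≅ F_{≥ g}`: the complex `T` of flat
modules is totally acyclic, and `F` is a semi-flat replacement of `M`. -/
structure IsTateFlatResolution (M T F : CochainComplex (ModuleCat.{u} R) ℤ) (g : ℤ) : Prop where
  totallyAcyclic : IsTotallyAcyclicFlat T
  semiFlat : IsSemiFlat F
  derivedIso : DerivedIso F M
  truncIso : Nonempty (truncGE T g ≅ truncGE F g)

/-- The Gorenstein flat dimension of a complex: the infimum, in `ℤ ∪ {±∞}`, of all integers `g`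
such that there is a Tate flat resolution `(T, F)` of `M` with `T_{≥ g} ≅ F_{≥ g}`. -/
noncomputable def gfd (M : CochainComplex (ModuleCat.{u} R) ℤ) : EReal :=
  sInf {x | ∃ g : ℤ, x = ((g : ℝ) : EReal) ∧
    ∃ T F : CochainComplex (ModuleCat.{u} R) ℤ, IsTateFlatResolution M T F g}

end Complexes

/-!
Existence of semi-projective resolutions, by the small object argument applied to the inclusions
of spheres into disks.
-/

section Resolutions

variable (R : Type u) [Ring R]

lemma rel_up (n : ℤ) : (ComplexShape.up ℤ).Rel n (n + 1) := by simp

variable {R} in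
/-- The disk `D^n(A)`, i.e. the identity of `A` in degrees `n` and `n + 1`. -/
noncomputable abbrev disk (A : ModuleCat.{u} R) (n : ℤ) : CochainComplex (ModuleCat.{u} R) ℤ :=
  HomologicalComplex.double (𝟙 A) (rel_up n)

variable {R} in
noncomputable abbrev diskX₀ (A : ModuleCat.{u} R) (n : ℤ) : (disk A n).X n ≅ A :=
  HomologicalComplex.doubleXIso₀ (𝟙 A) (rel_up n)

variable {R} in
noncomputable abbrev diskX₁ (A : ModuleCat.{u} R) (n : ℤ) : (disk A n).X (n + 1) ≅ A :=
  HomologicalComplex.doubleXIso₁ (𝟙 A) (rel_up n) (by simp)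

variable {R} in
lemma disk_d (A : ModuleCat.{u} R) (n : ℤ) :
    (disk A n).d n (n + 1) = (diskX₀ A n).hom ≫ (diskX₁ A n).inv := by
  rw [HomologicalComplex.double_d _ _ (by simp), Category.id_comp]

/-- The inclusion of the sphere `S^{n+1}(R)` into the disk `D^n(R)`. -/
noncomputable def sphereToDisk (n : ℤ) :
    (HomologicalComplex.single (ModuleCat.{u} R) (ComplexShape.up ℤ) (n + 1)).obj
      (ModuleCat.of R R) ⟶
    disk (ModuleCat.of R R) n :=
  HomologicalComplex.mkHomFromSingle
    (diskX₁ (ModuleCat.of R R) n).inv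
    (fun k _ ↦ by rw [HomologicalComplex.double_d_eq_zero₀ _ _ _ _ (by simp), comp_zero])

/-- The family of all inclusions of spheres into disks. -/
abbrev spheresToDisks : MorphismProperty (CochainComplex (ModuleCat.{u} R) ℤ) :=
  MorphismProperty.ofHoms (sphereToDisk R)

instance (n : ℤ) : Mono (sphereToDisk R n) := by
  have : ∀ i, Mono ((sphereToDisk R n).f i) := fun i ↦ by
    by_cases hi : i = n + 1
    · subst hi
      dsimp [sphereToDisk]
      simp only [HomologicalComplex.mkHomFromSingle_f]
      infer_instance
    · exact (HomologicalComplex.isZero_single_obj_X (ComplexShape.up ℤ) (n + 1) _ i hi).mono _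
  exact HomologicalComplex.mono_of_mono_f _ this

lemma spheresToDisks_le :
    spheresToDisks R ≤ MorphismProperty.monomorphisms _ := by
  rintro _ _ _ ⟨n⟩
  exact inferInstanceAs (Mono _)

instance : MorphismProperty.IsSmall.{u} (spheresToDisks R) :=
  MorphismProperty.isSmall_ofHoms.{u} (sphereToDisk R)

instance : MorphismProperty.HasSmallObjectArgument.{u} (spheresToDisks R) := by
  obtain ⟨κ, hκ', hκ⟩ := HasCardinalLT.exists_regular_cardinal_forall.{u}
    (fun n : ULift.{u} ℤ ↦ Subobject ((HomologicalComplex.single (ModuleCat.{u} R) (ComplexShape.up ℤ) (n.down + 1)).obj (ModuleCat.of R R)))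
  have : Fact κ.IsRegular := ⟨hκ'⟩
  have : Nonempty κ.ord.ToType := by simpa using hκ'.ne_zero
  have := WellFoundedLT.toOrderBot κ.ord.ToType
  exact ⟨κ, inferInstance, inferInstance,
    { preservesColimit {A B X Y} i hi f hf := by
        let hf' : (MorphismProperty.monomorphisms _).TransfiniteCompositionOfShape
            κ.ord.ToType f :=
          { toTransfiniteCompositionOfShape := hf.toTransfiniteCompositionOfShape
            map_mem j hj := by
              have := (hf.attachCells j hj).pushouts_coproducts
              simp only [MorphismProperty.ofHoms_homFamily] at this
              refine (?_ : _ ≤ MorphismProperty.monomorphisms _) _ this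
              rw [MorphismProperty.pushouts_le_iff]
              exact MorphismProperty.coproducts_le_iff.2 (spheresToDisks_le R) }
        have (j j' : κ.ord.ToType) (φ : j ⟶ j') : Mono (hf'.F.map φ) := hf'.mem_map φ
        apply IsGrothendieckAbelian.preservesColimit_coyoneda_obj_of_mono (Y := hf'.F) (κ := κ)
        obtain ⟨n⟩ := hi
        exact hκ ⟨n⟩ }⟩

variable {R}

/-- Every map from a sphere filled in `Y` and lifted to `X` can be filled in `X`. -/
def HasSphereFilling {X Y : CochainComplex (ModuleCat.{u} R) ℤ} (q : X ⟶ Y) : Prop :=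
  ∀ (n : ℤ) (z : ModuleCat.of R R ⟶ X.X (n + 1)) (y : ModuleCat.of R R ⟶ Y.X n),
    z ≫ X.d (n + 1) (n + 2) = 0 → z ≫ q.f (n + 1) = y ≫ Y.d n (n + 1) →
    ∃ x : ModuleCat.of R R ⟶ X.X n, x ≫ X.d n (n + 1) = z ∧ x ≫ q.f n = y

lemma hasSphereFilling_of_rlp {X Y : CochainComplex (ModuleCat.{u} R) ℤ} {q : X ⟶ Y}
    (hq : (spheresToDisks R).rlp q) : HasSphereFilling q := by
  intro n z y hz hzy
  have := hq _ ⟨n⟩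
  have hdd : ∀ k, (ComplexShape.up ℤ).Rel (n + 1) k → z ≫ X.d (n + 1) k = 0 := by
    intro k hk
    obtain rfl : n + 2 = k := by simp at hk; lia
    exact hz
  have hn : n ≠ n + 1 := by simp
  have sq : CommSq (HomologicalComplex.mkHomFromSingle z hdd) (sphereToDisk R n) q
      (HomologicalComplex.mkHomFromDouble (rel_up n) hn y (y ≫ Y.d n (n + 1)) (by simp)
        (by simp)) := ⟨by
    apply HomologicalComplex.from_single_hom_ext
    simp [sphereToDisk, hzy]⟩
  obtain ⟨ψ, hψ₁, hψ₂⟩ : ∃ ψ, sphereToDisk R n ≫ ψ = HomologicalComplex.mkHomFromSingle z hdd ∧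
      ψ ≫ q = HomologicalComplex.mkHomFromDouble (rel_up n) hn y (y ≫ Y.d n (n + 1)) (by simp)
        (by simp) := ⟨sq.lift, sq.fac_left, sq.fac_right⟩
  refine ⟨(diskX₀ _ n).inv ≫ ψ.f n, ?_, ?_⟩
  · have h := congr_arg
      (fun φ ↦ (HomologicalComplex.singleObjXSelf _ (n + 1) (ModuleCat.of R R)).inv ≫
        φ.f (n + 1)) hψ₁
    simp only [sphereToDisk, HomologicalComplex.comp_f, HomologicalComplex.mkHomFromSingle_f,
      Category.assoc, Iso.inv_hom_id_assoc] at h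
    rw [Category.assoc, ψ.comm, disk_d]
    simpa using h
  · rw [Category.assoc, ← HomologicalComplex.comp_f, hψ₂]
    simp

lemma rlp_of_hasSphereFilling {A B : CochainComplex (ModuleCat.{u} R) ℤ} {q : A ⟶ B}
    (hq : HasSphereFilling q) : (spheresToDisks R).rlp q := by
  rintro _ _ _ ⟨n⟩
  have hn : n ≠ n + 1 := by simp
  refine ⟨fun {t b} sq ↦ ?_⟩
  obtain ⟨x, hx₁, hx₂⟩ := hq n ((HomologicalComplex.singleObjXSelf _ _ _).inv ≫ t.f (n + 1))
    ((diskX₀ _ n).inv ≫ b.f n) (by simp) (by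
      have h := congr_arg
        (fun φ ↦ (HomologicalComplex.singleObjXSelf _ (n + 1) (ModuleCat.of R R)).inv ≫
          φ.f (n + 1)) sq.w
      simp only [sphereToDisk, HomologicalComplex.comp_f, HomologicalComplex.mkHomFromSingle_f,
        Category.assoc, Iso.inv_hom_id_assoc] at h
      rw [Category.assoc, h, Category.assoc, b.comm, disk_d]
      simp)
  have hx₃ : (x ≫ A.d n (n + 1)) ≫ q.f (n + 1) =
      (diskX₁ _ n).inv ≫ b.f (n + 1) := by
    rw [Category.assoc, ← q.comm, reassoc_of% hx₂, b.comm, disk_d]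
    simp
  refine ⟨⟨⟨HomologicalComplex.mkHomFromDouble _ hn x (x ≫ A.d n (n + 1)) (by simp) (by simp),
    ?_, ?_⟩⟩⟩
  · apply HomologicalComplex.from_single_hom_ext
    simp [sphereToDisk, hx₁]
  · apply HomologicalComplex.from_double_hom_ext
    · simp [hx₂]
    · rw [HomologicalComplex.comp_f, HomologicalComplex.mkHomFromDouble_f₁, Category.assoc, hx₃]
      simp

lemma quasiIso_of_hasSphereFilling {X Y : CochainComplex (ModuleCat.{u} R) ℤ} {q : X ⟶ Y}
    (hq : HasSphereFilling q) : QuasiIso q := by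
  have key (n : ℤ) {A : ModuleCat.{u} R} (z : A ⟶ X.X (n + 1)) (y : A ⟶ Y.X n)
      (hz : z ≫ X.d (n + 1) (n + 2) = 0) (hzy : z ≫ q.f (n + 1) = y ≫ Y.d n (n + 1)) :
      ∃ (A' : ModuleCat.{u} R) (π : A' ⟶ A) (_ : Epi π) (x : A' ⟶ X.X n),
        x ≫ X.d n (n + 1) = π ≫ z ∧ x ≫ q.f n = π ≫ y := by
    have hn : (ComplexShape.up ℤ).next (n + 1) = n + 2 := by simp; lia
    let fst' := pullback.fst (X.iCycles (n + 1) ≫ q.f (n + 1)) (Y.d n (n + 1)) ≫ X.iCycles (n + 1)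
    let snd' := pullback.snd (X.iCycles (n + 1) ≫ q.f (n + 1)) (Y.d n (n + 1))
    have hfst : fst' ≫ X.d (n + 1) (n + 2) = 0 := by simp [fst']
    have hfs : fst' ≫ q.f (n + 1) = snd' ≫ Y.d n (n + 1) := by
      simpa [fst', snd'] using
        pullback.condition (f := X.iCycles (n + 1) ≫ q.f (n + 1)) (g := Y.d n (n + 1))
    have lift {B : ModuleCat.{u} R} (z : B ⟶ X.X (n + 1)) (y : B ⟶ Y.X n)
        (hz : z ≫ X.d (n + 1) (n + 2) = 0) (hzy : z ≫ q.f (n + 1) = y ≫ Y.d n (n + 1)) :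
        ∃ t : B ⟶ pullback (X.iCycles (n + 1) ≫ q.f (n + 1)) (Y.d n (n + 1)),
          t ≫ fst' = z ∧ t ≫ snd' = y :=
      ⟨pullback.lift (X.liftCycles z (n + 2) hn hz) y (by simp [hzy]),
        by simp only [fst', pullback.lift_fst_assoc, HomologicalComplex.liftCycles_i],
        pullback.lift_snd _ _ _⟩
    have ext {B : ModuleCat.{u} R}
        {t t' : B ⟶ pullback (X.iCycles (n + 1) ≫ q.f (n + 1)) (Y.d n (n + 1))}
        (h₁ : t ≫ fst' = t' ≫ fst') (h₂ : t ≫ snd' = t' ≫ snd') : t = t' := by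
      apply pullback.hom_ext _ h₂
      rw [← cancel_mono (X.iCycles _)]
      simpa only [Category.assoc] using h₁
    obtain ⟨τ, hτ₁, hτ₂⟩ := lift (X.d n (n + 1)) (q.f n) (by simp) (by simp)
    have : Epi τ := by
      rw [ModuleCat.epi_iff_surjective]
      intro t
      let t' : ModuleCat.of R R ⟶ pullback (X.iCycles (n + 1) ≫ q.f (n + 1)) (Y.d n (n + 1)) :=
        ModuleCat.ofHom (LinearMap.toSpanSingleton R _ t)
      obtain ⟨x, hx₁, hx₂⟩ := hq n (t' ≫ fst') (t' ≫ snd') (by rw [Category.assoc, hfst, comp_zero])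
        (by rw [Category.assoc, hfs, Category.assoc])
      have h : x ≫ τ = t' := ext (by rw [Category.assoc, hτ₁, hx₁]) (by rw [Category.assoc, hτ₂, hx₂])
      refine ⟨x (1 : R), (ConcreteCategory.congr_hom h (1 : R)).trans ?_⟩
      exact one_smul R t
    obtain ⟨t, ht₁, ht₂⟩ := lift z y hz hzy
    obtain ⟨A', π, hπ, x, hx⟩ := surjective_up_to_refinements_of_epi τ t
    exact ⟨A', π, hπ, x, by rw [← hτ₁, ← reassoc_of% hx, ht₁], by rw [← hτ₂, ← reassoc_of% hx, ht₂]⟩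
  refine ⟨fun n ↦ ?_⟩
  rw [quasiIsoAt_iff_isIso_homologyMap]
  obtain ⟨m, rfl⟩ : ∃ m, n = m + 1 := ⟨n - 1, by simp⟩
  have : Mono (HomologicalComplex.homologyMap q (m + 1)) := by
    rw [HomologicalComplex.mono_homologyMap_iff_up_to_refinements q m (m + 1) (m + 2)
      (by simp) (by simp; lia)]
    intro A z hz y hy
    obtain ⟨A', π, hπ, x, hx₁, _⟩ := key m z y hz hy
    exact ⟨A', π, hπ, x, hx₁.symm⟩
  have : Epi (HomologicalComplex.homologyMap q (m + 1)) := by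
    rw [HomologicalComplex.epi_homologyMap_iff_up_to_refinements q m (m + 1) (m + 1 + 1)
      (by simp) (by simp)]
    intro A y hy
    obtain ⟨A', π, hπ, x, hx₁, hx₂⟩ := key (m + 1) (0 : A ⟶ _) y (by simp) (by simp [hy])
    exact ⟨A', π, hπ, x, by simpa using hx₁, 0, by simp [hx₂]⟩
  exact isIso_of_mono_of_epi _

lemma hasSphereFilling_of_acyclic {X Y : CochainComplex (ModuleCat.{u} R) ℤ} {q : X ⟶ Y}
    (hX : X.Acyclic) (hY : Y.Acyclic) (hq : ∀ n, Epi (q.f n)) : HasSphereFilling q := by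
  have lift {Z : CochainComplex (ModuleCat.{u} R) ℤ} (hZ : Z.Acyclic) {a b c : ℤ}
      (hab : a + 1 = b) (hbc : b + 1 = c)
      (z : ModuleCat.of R R ⟶ Z.X b) (hz : z ≫ Z.d b c = 0) :
      ∃ w : ModuleCat.of R R ⟶ Z.X a, w ≫ Z.d a b = z := by
    have h := hZ b
    rw [HomologicalComplex.exactAt_iff' _ a b c (by simp; lia) (by simp; lia)] at h
    exact ⟨h.liftFromProjective z hz, h.liftFromProjective_comp z hz⟩
  intro n z y hz hzy
  obtain ⟨w, hw⟩ := lift hX rfl (by lia) z hz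
  obtain ⟨e, he⟩ := lift hY (sub_add_cancel n 1) rfl (y - w ≫ q.f n)
    (by rw [Preadditive.sub_comp, Category.assoc, q.comm, reassoc_of% hw, hzy, sub_self])
  refine ⟨w + Projective.factorThru e (q.f (n - 1)) ≫ X.d (n - 1) n, by simp [hw], ?_⟩
  rw [Preadditive.add_comp, Category.assoc, ← q.comm, Projective.factorThru_comp_assoc, he]
  simp

variable {P : CochainComplex (ModuleCat.{u} R) ℤ}

lemma exists_lift_of_llp {Z : CochainComplex (ModuleCat.{u} R) ℤ} (hZ : IsZero Z) {i : Z ⟶ P}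
    (hi : (spheresToDisks R).rlp.llp i)
    {X Y : CochainComplex (ModuleCat.{u} R) ℤ} {q : X ⟶ Y} (hX : X.Acyclic) (hY : Y.Acyclic)
    (hq : ∀ n, Epi (q.f n)) (φ : P ⟶ Y) : ∃ ψ : P ⟶ X, ψ ≫ q = φ := by
  have := hi q (rlp_of_hasSphereFilling (hasSphereFilling_of_acyclic hX hY hq))
  have sq : CommSq (hZ.to_ X) i q φ := ⟨hZ.eq_of_src _ _⟩
  exact ⟨sq.lift, sq.fac_right⟩

lemma exists_contractible_epi (L : CochainComplex (ModuleCat.{u} R) ℤ) :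
    ∃ (X : CochainComplex (ModuleCat.{u} R) ℤ) (_ : Homotopy (𝟙 X) 0) (q : X ⟶ L),
      ∀ n, Epi (q.f n) := by
  let K := L⟦(-1 : ℤ)⟧
  let e : K⟦(1 : ℤ)⟧ ≅ L := (shiftEquiv (CochainComplex (ModuleCat.{u} R) ℤ) (1 : ℤ)).counitIso.app L
  let q : CochainComplex.mappingCone (𝟙 K) ⟶ K⟦(1 : ℤ)⟧ :=
    (CochainComplex.mappingCone.triangle (𝟙 K)).mor₃
  refine ⟨CochainComplex.mappingCone (𝟙 K), CochainComplex.mappingCone.homotopyToZeroOfId _,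
    q ≫ e.hom, fun n ↦ ?_⟩
  have hq : (CochainComplex.mappingCone.inl (𝟙 K)).v (n + 1) n (by lia) ≫ q.f n =
      -(K.shiftFunctorObjXIso 1 n (n + 1) rfl).inv :=
    CochainComplex.mappingCone.inl_v_triangle_mor₃_f (𝟙 K) (n + 1) n _
  have h1 : Epi ((CochainComplex.mappingCone.inl (𝟙 K)).v (n + 1) n (by lia) ≫ q.f n) := by
    rw [hq]; infer_instance
  have h2 : Epi (q.f n) := epi_of_epi ((CochainComplex.mappingCone.inl (𝟙 K)).v (n + 1) n _) _
  have h3 : Epi (e.hom.f n) := inferInstance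
  rw [HomologicalComplex.comp_f]
  exact epi_comp _ _

lemma acyclic_of_contractible {X : CochainComplex (ModuleCat.{u} R) ℤ} (h : Homotopy (𝟙 X) 0) :
    X.Acyclic := fun n ↦ by
  rw [HomologicalComplex.exactAt_iff_isZero_homology, IsZero.iff_id_eq_zero,
    ← HomologicalComplex.homologyMap_id, h.homologyMap_eq, HomologicalComplex.homologyMap_zero]

lemma isKProjective_of_llp {Z : CochainComplex (ModuleCat.{u} R) ℤ} (hZ : IsZero Z) {i : Z ⟶ P}
    (hi : (spheresToDisks R).rlp.llp i) : P.IsKProjective where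
  nonempty_homotopy_zero {L} f hL := by
    obtain ⟨X, h, q, hq⟩ := exists_contractible_epi L
    obtain ⟨ψ, rfl⟩ := exists_lift_of_llp hZ hi (acyclic_of_contractible h) hL hq f
    exact ⟨(Homotopy.ofEq (by simp)).trans
      (((h.compRight q).compLeft ψ).trans (Homotopy.ofEq (by simp)))⟩

open Classical in
/-- The map from `K` to a disk given by a map in the upper degree of the disk. -/
noncomputable def toDisk {K : CochainComplex (ModuleCat.{u} R) ℤ} {A : ModuleCat.{u} R} (m : ℤ)
    (φ : K.X (m + 1) ⟶ A) :
    K ⟶ disk A m where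
  f k :=
    if h₀ : k = m then K.d k (m + 1) ≫ φ ≫ (diskX₀ A m).inv ≫ ((disk A m).XIsoOfEq h₀).inv
    else if h₁ : k = m + 1 then
      (K.XIsoOfEq h₁).hom ≫ φ ≫ (diskX₁ A m).inv ≫ ((disk A m).XIsoOfEq h₁).inv
    else 0
  comm' k l hkl := by
    obtain rfl : k + 1 = l := by simpa using hkl
    by_cases h₀ : k = m
    · subst h₀
      rw [dif_pos rfl, dif_neg (by simp), dif_pos rfl]
      simp [disk_d, HomologicalComplex.XIsoOfEq]
    · rw [dif_neg h₀, dif_neg (show k + 1 ≠ m + 1 by lia),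
        HomologicalComplex.double_d_eq_zero₀ _ _ _ _ h₀, comp_zero]
      by_cases h₁ : k + 1 = m
      · rw [dif_pos h₁]; simp
      · rw [dif_neg h₁, comp_zero]

lemma toDisk_f {K : CochainComplex (ModuleCat.{u} R) ℤ} {A : ModuleCat.{u} R} (m : ℤ)
    (φ : K.X (m + 1) ⟶ A) :
    (toDisk m φ).f (m + 1) =
      φ ≫ (diskX₁ A m).inv := by
  simp [toDisk, HomologicalComplex.XIsoOfEq]

lemma acyclic_disk (A : ModuleCat.{u} R) (m : ℤ) :
    (disk A m).Acyclic := by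
  have hm : m ≠ m + 1 := by simp
  intro n
  rw [HomologicalComplex.exactAt_iff_exact_up_to_refinements _ (n - 1) n (n + 1)
    (by simp) (by simp)]
  intro B x hx
  by_cases h₀ : n = m
  · subst h₀
    refine ⟨B, 𝟙 B, inferInstance, 0, ?_⟩
    have h := congr_arg (fun φ ↦ φ ≫ (diskX₁ A n).hom ≫ (diskX₀ A n).inv) hx
    rw [disk_d] at h
    simpa using h
  · by_cases h₁ : n = m + 1
    · subst h₁
      obtain ⟨k, hk⟩ : ∃ k, k = m + 1 - 1 := ⟨_, rfl⟩
      rw [← hk]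
      obtain rfl : k = m := by lia
      refine ⟨B, 𝟙 B, inferInstance, x ≫ (diskX₁ A k).hom ≫
        (diskX₀ A k).inv, ?_⟩
      rw [disk_d]
      simp
    · exact ⟨B, 𝟙 B, inferInstance, 0,
        (HomologicalComplex.isZero_double_X (𝟙 A) _ n h₀ h₁).eq_of_tgt _ _⟩

lemma projective_of_llp {Z : CochainComplex (ModuleCat.{u} R) ℤ} (hZ : IsZero Z) {i : Z ⟶ P}
    (hi : (spheresToDisks R).rlp.llp i) (n : ℤ) : Projective (P.X n) where
  factors {B A} φ e he := by
    obtain ⟨m, rfl⟩ : ∃ m, n = m + 1 := ⟨n - 1, by simp⟩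
    have hm : m ≠ m + 1 := by simp
    let q : disk B m ⟶ disk A m :=
      HomologicalComplex.mkHomFromDouble _ hm
        (e ≫ (diskX₀ A m).inv)
        (e ≫ (diskX₁ A m).inv)
        (by rw [disk_d]; simp)
        (fun k hk ↦ by
          rw [HomologicalComplex.double_d_eq_zero₀ _ _ _ _ hm.symm, comp_zero])
    obtain ⟨ψ, hψ⟩ := exists_lift_of_llp hZ hi (acyclic_disk B m) (acyclic_disk A m) (q := q)
      (fun k ↦ by
        by_cases h₀ : k = m
        · subst h₀
          rw [HomologicalComplex.mkHomFromDouble_f₀]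
          infer_instance
        · by_cases h₁ : k = m + 1
          · subst h₁
            rw [HomologicalComplex.mkHomFromDouble_f₁]
            infer_instance
          · exact (HomologicalComplex.isZero_double_X (𝟙 A) _ k h₀ h₁).epi _) (toDisk m φ)
    refine ⟨ψ.f (m + 1) ≫ (diskX₁ B m).hom, ?_⟩
    have h := congr_arg (fun χ ↦ χ.f (m + 1) ≫ (diskX₁ A m).hom) hψ
    simpa [q, toDisk_f] using h

theorem exists_semiProjective_resolution (M : CochainComplex (ModuleCat.{u} R) ℤ) :
    ∃ (P : CochainComplex (ModuleCat.{u} R) ℤ) (π : P ⟶ M),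
      IsSemiProjective P ∧ QuasiIso π := by
  let fac := MorphismProperty.factorizationData (spheresToDisks R).rlp.llp (spheresToDisks R).rlp
    (0 : (0 : CochainComplex (ModuleCat.{u} R) ℤ) ⟶ M)
  exact ⟨fac.Z, fac.p, ⟨projective_of_llp (isZero_zero _) fac.hi,
    isKProjective_of_llp (isZero_zero _) fac.hi⟩,
    quasiIso_of_hasSphereFilling (hasSphereFilling_of_rlp fac.hp)⟩

/-- A chosen semi-projective resolution of `M`. -/
noncomputable def semiProjectiveResolution (M : CochainComplex (ModuleCat.{u} R) ℤ) :
    CochainComplex (ModuleCat.{u} R) ℤ :=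
  (exists_semiProjective_resolution M).choose

end Resolutions

section DerivedExtendScalars

variable {R S : Type u} [Ring R] [Ring S] (f : R →+* S)

/-- The derived tensor product `S ⊗^L_R M`, as an `S`-complex: `S ⊗_R P` for a semi-projective
resolution `P` of `M`. -/
noncomputable def derivedExtendScalars (M : CochainComplex (ModuleCat.{u} R) ℤ) :
    CochainComplex (ModuleCat.{u} S) ℤ :=
  ((extendScalarsFunctor f).mapHomologicalComplex (ComplexShape.up ℤ)).obj
    (semiProjectiveResolution M)

/-- `S` as a left `R`-module. -/
noncomputable abbrev asLeftModule : ModuleCat.{u} R :=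
  (ModuleCat.restrictScalars f).obj (ModuleCat.of S S)

/-- `S` as a right `R`-module. -/
noncomputable abbrev asRightModule : ModuleCat.{u} Rᵐᵒᵖ :=
  (ModuleCat.restrictScalars (RingHom.op f)).obj (ModuleCat.of Sᵐᵒᵖ S)

end DerivedExtendScalars

end GorFlat

/-! Every Tate flat resolution `(T, F)` of `M` that agrees in degrees `≥ g` is carried by `S ⊗_R -`
to one of `S ⊗^L_R M` with the same `g`; the inequality is then an inclusion of index sets. The
basic tool is the natural isomorphism `X ⊗_S (S ⊗_R N) ≅ X ⊗_R N` for right `S`-modules `X`, which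
turns flatness, semi-flatness and total acyclicity over `S` into statements over `R` about
restricted modules.

Total acyclicity of `S ⊗_R T` uses both flat dimensions, by dimension shifting. Tensoring a short
exact sequence of right modules with the flat complex `T` gives a short exact sequence of complexes,
so acyclicity of two terms passes to the third. Applied to a flat resolution of `S` as a right
module, this makes `S ⊗_R T` acyclic (`tensorModuleComplex_acyclic`). An injective right `S`-module
`J` is a direct summand of `Hom_ℤ(S, D)` with `D` an injective abelian group. If `L` is flat,
`Hom_ℤ(L, D)` is injective; a flat resolution of `S` as a left module therefore yields acyclicity of
`Hom_ℤ(S, D) ⊗_R T`, hence of `J ⊗_R T` (`homModule_tensor_acyclic`,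
`restrict_injective_tensor_acyclic`).

Finally, a semi-projective resolution `P` of `M` admits a quasi-isomorphism `P ⟶ F`. Its cone is an
acyclic complex of flat modules, so it stays acyclic under `S ⊗_R -`, and `S ⊗_R F` represents `S
⊗^L_R M` (`derivedIso_extendComplex`). -/

namespace GorFlat

/-! ### Balanced tensor products and their exactness -/

section Balanced

variable {R : Type u} [Ring R]

section

variable {X M : Type u} [AddCommGroup X] [Module Rᵐᵒᵖ X] [AddCommGroup M] [Module R M]

variable (R) in
/-- The class of `x ⊗ m` in `X ⊗_R M`. -/
abbrev btmul (x : X) (m : M) : BalancedTensor R X M := QuotientAddGroup.mk (x ⊗ₜ[ℤ] m)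

lemma btmul_add (x : X) (m n : M) : btmul R x (m + n) = btmul R x m + btmul R x n := by
  rw [btmul, TensorProduct.tmul_add]; rfl

lemma add_btmul (x y : X) (m : M) : btmul R (x + y) m = btmul R x m + btmul R y m := by
  rw [btmul, TensorProduct.add_tmul]; rfl

lemma smul_btmul (r : R) (x : X) (m : M) : btmul R (op r • x) m = btmul R x (r • m) := by
  rw [btmul, btmul, ← sub_eq_zero, ← QuotientAddGroup.mk_sub, QuotientAddGroup.eq_zero_iff]
  exact AddSubgroup.subset_closure ⟨x, r, m, rfl⟩

variable (R X M) in
/-- The universal balanced biadditive map. -/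
def btmulHom : X →+ M →+ BalancedTensor R X M :=
  AddMonoidHom.mk' (fun x ↦ AddMonoidHom.mk' (btmul R x) (btmul_add x))
    fun x y ↦ by ext m; exact add_btmul x y m

variable (R) in
/-- The additive map on `X ⊗_R M` given by a balanced biadditive map. -/
noncomputable def balancedLift {A : Type u} [AddCommGroup A] (β : X →+ M →+ A)
    (h : ∀ (r : R) x m, β (op r • x) m = β x (r • m)) : BalancedTensor R X M →+ A :=
  QuotientAddGroup.lift _ (TensorProduct.liftAddHom β (by simp)) (by
    rw [balancedSubgroup, AddSubgroup.closure_le]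
    rintro _ ⟨x, r, m, rfl⟩
    simp [h])

lemma balancedMap_surjective {X' : Type u} [AddCommGroup X'] [Module Rᵐᵒᵖ X']
    (φ : X →ₗ[Rᵐᵒᵖ] X') (hφ : Function.Surjective φ) :
    Function.Surjective (balancedMap R φ (LinearMap.id (M := M))) := by
  rw [← AddMonoidHom.range_eq_top, eq_top_iff]
  rintro t -
  obtain ⟨t, rfl⟩ := QuotientAddGroup.mk_surjective t
  induction t using TensorProduct.induction_on with
  | zero => exact zero_mem _
  | tmul x m =>
    obtain ⟨x, rfl⟩ := hφ x
    exact ⟨btmul R x m, rfl⟩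
  | add a b ha hb => exact add_mem ha hb

/-- Right exactness of `- ⊗_R M`. -/
lemma balancedMap_exact {X' X'' : Type u} [AddCommGroup X'] [Module Rᵐᵒᵖ X']
    [AddCommGroup X''] [Module Rᵐᵒᵖ X''] (φ : X →ₗ[Rᵐᵒᵖ] X') (ψ : X' →ₗ[Rᵐᵒᵖ] X'')
    (h : ∀ x, ψ x = 0 → ∃ y, φ y = x) (hψ : Function.Surjective ψ)
    (t : BalancedTensor R X' M) (ht : balancedMap R ψ LinearMap.id t = 0) :
    ∃ s, balancedMap R φ (LinearMap.id (M := M)) s = t := by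
  -- The projection modulo the image `N` kills `ker ψ ⊗ M`, so it factors through `X'' ⊗ M` as `l`.
  -- An element killed by `ψ ⊗ M` is then zero modulo `N`.
  let N := (balancedMap R φ (LinearMap.id (M := M))).range
  let γ : X' →+ M →+ BalancedTensor R X' M ⧸ N :=
    ((QuotientAddGroup.mk' N).compHom).comp (btmulHom R X' M)
  have hγ : ψ.toAddMonoidHom.ker ≤ γ.ker := by
    intro x hx
    obtain ⟨y, rfl⟩ := h x hx
    ext m
    exact (QuotientAddGroup.eq_zero_iff _).2 ⟨btmul R y m, rfl⟩
  let β : X'' →+ M →+ BalancedTensor R X' M ⧸ N :=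
    AddMonoidHom.liftOfSurjective ψ.toAddMonoidHom hψ ⟨γ, hγ⟩
  have hβ (x : X') : β (ψ x) = γ x :=
    AddMonoidHom.liftOfRightInverse_comp_apply ψ.toAddMonoidHom _ _ ⟨γ, hγ⟩ x
  let l := balancedLift R β (fun r x m ↦ by
    obtain ⟨x, rfl⟩ := hψ x
    rw [← map_smul, hβ, hβ]
    exact congr_arg (QuotientAddGroup.mk' N) (smul_btmul r x m))
  have hl : l.comp (balancedMap R ψ LinearMap.id) = QuotientAddGroup.mk' N :=
    balancedTensor_ext fun x m ↦ DFunLike.congr_fun (hβ x) m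
  have := DFunLike.congr_fun hl t
  rw [AddMonoidHom.comp_apply, ht, map_zero] at this
  exact (QuotientAddGroup.eq_zero_iff _).1 this.symm

end

/-- The functor `- ⊗_R M`. -/
noncomputable abbrev tensorRight (M : ModuleCat.{u} R) : ModuleCat.{u} Rᵐᵒᵖ ⥤ AddCommGrpCat.{u} :=
  (tensorBifunctor R).flip.obj M

/-- The functor `X ⊗_R -`. -/
noncomputable abbrev tensorLeft (X : ModuleCat.{u} Rᵐᵒᵖ) : ModuleCat.{u} R ⥤ AddCommGrpCat.{u} :=
  (tensorBifunctor R).obj X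

instance (M : ModuleCat.{u} R) : (tensorRight M).Additive where
  map_add {X Y f g} := by
    change ((tensorBifunctor R).map (f + g)).app M = _
    rw [Functor.map_add]; rfl

lemma tensorRight_shortExact {M : ModuleCat.{u} R} (hM : IsFlat M)
    (T : ShortComplex (ModuleCat.{u} Rᵐᵒᵖ)) (hT : T.ShortExact) :
    (T.map (tensorRight M)).ShortExact where
  mono_f := hM T.f hT.mono_f
  epi_g := by
    rw [AddCommGrpCat.epi_iff_surjective]
    exact balancedMap_surjective _ ((ModuleCat.epi_iff_surjective _).1 hT.epi_g)
  exact := by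
    rw [ShortComplex.ab_exact_iff]
    have := hT.exact
    rw [ShortComplex.moduleCat_exact_iff] at this
    exact balancedMap_exact T.f.hom T.g.hom this ((ModuleCat.epi_iff_surjective _).1 hT.epi_g)

lemma tensorRight_preservesHomology {M : ModuleCat.{u} R} (hM : IsFlat M) :
    (tensorRight M).PreservesHomology :=
  ((Functor.exact_tfae (tensorRight M)).out 0 2).1 (tensorRight_shortExact hM)

/-- Exactness is a condition on elements and does not see the scalars. -/
lemma restrictScalars_preservesHomology {A B : Type u} [Ring A] [Ring B] (g : A →+* B) :
    (ModuleCat.restrictScalars.{u} g).PreservesHomology := by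
  refine ((Functor.exact_tfae (ModuleCat.restrictScalars.{u} g)).out 1 2).1 fun T hT ↦ ?_
  rw [ShortComplex.moduleCat_exact_iff] at hT ⊢
  exact hT

/-- `X ⊗_R M ≅ M ⊗_{Rᵒᵖ} X`. -/
noncomputable def tensorLeftIso (X : ModuleCat.{u} Rᵐᵒᵖ) :
    tensorLeft X ≅ ModuleCat.restrictScalars ((RingEquiv.opOp R).symm : Rᵐᵒᵖᵐᵒᵖ →+* R) ⋙
      tensorRight (R := Rᵐᵒᵖ) X :=
  NatIso.ofComponents (fun M ↦ AddEquiv.toAddCommGrpIso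
    (Y := AddCommGrpCat.of (BalancedTensor Rᵐᵒᵖ
      ((ModuleCat.restrictScalars ((RingEquiv.opOp R).symm : Rᵐᵒᵖᵐᵒᵖ →+* R)).obj M) X))
    (AddMonoidHom.toAddEquiv
      (balancedLift R (X := X) (M := M) (btmulHom Rᵐᵒᵖ
        ((ModuleCat.restrictScalars ((RingEquiv.opOp R).symm : Rᵐᵒᵖᵐᵒᵖ →+* R)).obj M) X).flip
        fun r x m ↦ (smul_btmul (op r)
          (X := (ModuleCat.restrictScalars ((RingEquiv.opOp R).symm : Rᵐᵒᵖᵐᵒᵖ →+* R)).obj M)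
          m x).symm)
      (balancedLift Rᵐᵒᵖ (M := X)
        (X := (ModuleCat.restrictScalars ((RingEquiv.opOp R).symm : Rᵐᵒᵖᵐᵒᵖ →+* R)).obj M)
        (btmulHom R X M).flip
        fun r m x ↦ (smul_btmul (unop r) (X := X) (M := M) x m).symm)
      (balancedTensor_ext (X := X) (M := M) fun _ _ ↦ rfl)
      (balancedTensor_ext (R := Rᵐᵒᵖ) (M := X)
        (X := (ModuleCat.restrictScalars ((RingEquiv.opOp R).symm : Rᵐᵒᵖᵐᵒᵖ →+* R)).obj M)
        fun _ _ ↦ rfl)))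
    fun {M _} _ ↦ AddCommGrpCat.hom_ext (balancedTensor_ext (X := X) (M := M) fun _ _ ↦ rfl)

/-- Flatness of `X` as a left `Rᵐᵒᵖ`-module concerns `- ⊗ X` on modules over `Rᵐᵒᵖᵐᵒᵖ`. Swapping the
factors identifies `X ⊗_R -` with this functor after the exact restriction along `Rᵐᵒᵖᵐᵒᵖ ≅ R`. -/
lemma tensorLeft_preservesHomology {X : ModuleCat.{u} Rᵐᵒᵖ} (hX : IsFlat X) :
    (tensorLeft X).PreservesHomology := by
  have := tensorRight_preservesHomology hX
  have := restrictScalars_preservesHomology ((RingEquiv.opOp R).symm : Rᵐᵒᵖᵐᵒᵖ →+* R)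
  refine ((Functor.exact_tfae (tensorLeft X)).out 1 2).1 fun T hT ↦ ?_
  exact ShortComplex.exact_of_iso (T.mapNatIso (tensorLeftIso X).symm)
    ((hT.map (ModuleCat.restrictScalars _)).map (tensorRight (R := Rᵐᵒᵖ) X))

end Balanced

/-! ### Closure properties of flat modules -/

section Flat

variable {R : Type u} [Ring R]

/-- A linear section `s` of the canonical map from the free module on `P` embeds `X ⊗_R P` into `P
→₀ X` by `x ⊗ p ↦ x · s(p)`, naturally in `X` and with retraction `B`. On `P →₀ X` an injective `φ`
acts injectively, coordinate by coordinate. -/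
lemma isFlat_of_projective {P : ModuleCat.{u} R} (hP : Projective P) : IsFlat P := by
  have : Module.Projective R P := (IsProjective.iff_projective P).2 hP
  obtain ⟨s, hs⟩ := (Module.projective_def' (R := R) (P := P)).1 this
  have hs (p : P) : (s p).sum (fun i r ↦ r • i) = p := DFunLike.congr_fun hs p
  let D (X : ModuleCat.{u} Rᵐᵒᵖ) : BalancedTensor R X P →+ (P →₀ X) :=
    balancedLift R (AddMonoidHom.mk' (fun x ↦ AddMonoidHom.mk'
      (fun p ↦ (s p).mapRange (fun r ↦ op r • x) (by simp))
      (fun p q ↦ by ext; simp [add_smul]))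
      (fun x y ↦ by ext; simp)) (fun r x p ↦ by ext; simp [mul_smul])
  intro X Y φ hφ
  rw [ModuleCat.mono_iff_injective] at hφ
  rw [AddCommGrpCat.mono_iff_injective]
  let B : (P →₀ X) →+ BalancedTensor R X P :=
    Finsupp.liftAddHom (fun i ↦ (btmulHom R X P).flip i)
  have hB : B.comp (D X) = AddMonoidHom.id _ := balancedTensor_ext (X := X) (M := P) fun x p ↦ by
    change ((s p).mapRange (fun r ↦ op r • x) (by simp)).sum (fun i x ↦ btmul R x i) = btmul R x p
    rw [Finsupp.sum_mapRange_index (fun i ↦ by simp [btmul])]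
    conv_rhs => rw [← hs p]
    rw [Finsupp.sum, Finsupp.sum]
    refine Eq.trans ?_ (map_sum (btmulHom R X P x) _ _).symm
    exact Finset.sum_congr rfl fun i _ ↦ smul_btmul (s p i) x i
  have hn : (D Y).comp (balancedMap R φ.hom LinearMap.id) =
      (Finsupp.mapRange.addMonoidHom φ.hom.toAddMonoidHom).comp (D X) :=
    balancedTensor_ext (X := X) (M := P) fun x p ↦ by
      ext i
      exact (map_smul φ.hom (op (s p i)) x).symm
  have hD : Function.Injective (D X) :=
    Function.LeftInverse.injective (g := B) (DFunLike.congr_fun hB)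
  have hc : Function.Injective ((D Y).comp (balancedMap R φ.hom LinearMap.id)) := by
    rw [hn]
    exact (Finsupp.mapRange_injective _ (map_zero φ.hom) hφ).comp hD
  exact Function.Injective.of_comp (f := D Y) hc

lemma isFlat_of_iso {M N : ModuleCat.{u} R} (e : M ≅ N) (hM : IsFlat M) : IsFlat N := by
  intro X Y φ hφ
  have := hM φ hφ
  exact (MorphismProperty.monomorphisms _).arrow_mk_iso_iff
    (Arrow.isoMk (((tensorBifunctor R).obj X).mapIso e) (((tensorBifunctor R).obj Y).mapIso e)
      (((tensorBifunctor R).map φ).naturality e.hom)) |>.1 this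

/-- Needed for the terms of a mapping cone. By naturality a morphism `t` killed by `φ ⊗ (M ⊞ N)`
vanishes after each projection, and `biprod.total` recovers `t` from the two. -/
lemma isFlat_biprod {M N : ModuleCat.{u} R} (hM : IsFlat M) (hN : IsFlat N) :
    IsFlat (M ⊞ N) := by
  intro X Y φ hφ
  have h₁ := hM φ hφ
  have h₂ := hN φ hφ
  refine Preadditive.mono_of_cancel_zero _ fun t ht ↦ ?_
  have e₁ : t ≫ (tensorLeft X).map biprod.fst = 0 := by
    rw [← cancel_mono (((tensorBifunctor R).map φ).app M), Category.assoc, NatTrans.naturality,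
      reassoc_of% ht, zero_comp, zero_comp]
  have e₂ : t ≫ (tensorLeft X).map biprod.snd = 0 := by
    rw [← cancel_mono (((tensorBifunctor R).map φ).app N), Category.assoc, NatTrans.naturality,
      reassoc_of% ht, zero_comp, zero_comp]
  rw [← Category.comp_id t, ← (tensorLeft X).map_id, ← biprod.total, Functor.map_add,
    Functor.map_comp, Functor.map_comp, Preadditive.comp_add, reassoc_of% e₁, reassoc_of% e₂]
  simp

end Flat

/-! ### Dimension shifting along flat resolutions -/

section Acyclicity

variable {R : Type u} [Ring R]

/-- The complex `X ⊗_R T` for a single right module `X`. -/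
noncomputable abbrev tensorModuleComplex (X : ModuleCat.{u} Rᵐᵒᵖ)
    (T : CochainComplex (ModuleCat.{u} R) ℤ) : CochainComplex AddCommGrpCat.{u} ℤ :=
  ((tensorLeft X).mapHomologicalComplex (ComplexShape.up ℤ)).obj T

/-- The sequence of complexes obtained by tensoring a sequence of right modules with `T`. -/
noncomputable abbrev tensorShortComplex (E : ShortComplex (ModuleCat.{u} Rᵐᵒᵖ))
    (T : CochainComplex (ModuleCat.{u} R) ℤ) : ShortComplex (CochainComplex AddCommGrpCat.{u} ℤ) :=
  ShortComplex.mk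
    ((NatTrans.mapHomologicalComplex ((tensorBifunctor R).map E.f) (ComplexShape.up ℤ)).app T)
    ((NatTrans.mapHomologicalComplex ((tensorBifunctor R).map E.g) (ComplexShape.up ℤ)).app T)
    (by
      ext1 i
      exact (E.map (tensorRight (T.X i))).zero)

lemma tensorShortComplex_shortExact {E : ShortComplex (ModuleCat.{u} Rᵐᵒᵖ)} (hE : E.ShortExact)
    {T : CochainComplex (ModuleCat.{u} R) ℤ} (hT : ∀ i, IsFlat (T.X i)) :
    (tensorShortComplex E T).ShortExact :=
  HomologicalComplex.shortExact_of_degreewise_shortExact _ fun i ↦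
    tensorRight_shortExact (hT i) E hE

/-- `acyclic_X₁` and `acyclic_X₃` expect the two known terms of a short exact sequence in this form.
-/
lemma quasiIso_of_acyclic {C : Type*} [Category* C] [Abelian C] {K L : CochainComplex C ℤ}
    (φ : K ⟶ L) (hK : K.Acyclic) (hL : L.Acyclic) : QuasiIso φ where
  quasiIsoAt i := (quasiIsoAt_iff_exactAt φ i (hK i)).2 (hL i)

lemma acyclic_map {C D : Type*} [Category* C] [Category* D] [Abelian C] [Abelian D] (F : C ⥤ D)
    [F.Additive] [F.PreservesHomology] {T : CochainComplex C ℤ} (hT : T.Acyclic) :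
    ((F.mapHomologicalComplex (ComplexShape.up ℤ)).obj T).Acyclic :=
  fun i ↦ (hT i).map F

/-- If `X` has finite flat dimension, then `X ⊗_R T` is acyclic for every acyclic complex `T` of
flat modules. -/
lemma tensorModuleComplex_acyclic {T : CochainComplex (ModuleCat.{u} R) ℤ}
    (hT : ∀ i, IsFlat (T.X i)) (hT' : T.Acyclic) (n : ℕ) :
    ∀ X : ModuleCat.{u} Rᵐᵒᵖ, HasFlatDimLE n X → (tensorModuleComplex X T).Acyclic := by
  induction n with
  | zero =>
    intro X hX
    have := tensorLeft_preservesHomology hX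
    exact acyclic_map _ hT'
  | succ n ih =>
    -- In `0 → K ⊗ T → F ⊗ T → X ⊗ T → 0` the first term is acyclic by induction and the second
    -- because `F ⊗ -` is exact.
    rintro X ⟨K, F, i, p, w, h, hF, hK⟩
    have := tensorLeft_preservesHomology hF
    have hF' : (tensorModuleComplex F T).Acyclic := acyclic_map _ hT'
    exact (tensorShortComplex_shortExact h hT).acyclic_X₃ (quasiIso_of_acyclic _ (ih K hK) hF')

end Acyclicity

/-! ### The right modules `Hom_ℤ(L, D)` -/

section HomModule

variable {R : Type u} [Ring R]

/-- The group `Hom_ℤ(L, D)`, as a right `R`-module for a left `R`-module `L`. -/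
@[nolint unusedArguments]
def HomGroup (R L D : Type u) [Ring R] [AddCommGroup L] [Module R L] [AddCommGroup D] : Type u :=
  L →+ D

instance (R L D : Type u) [Ring R] [AddCommGroup L] [Module R L] [AddCommGroup D] :
    AddCommGroup (HomGroup R L D) := inferInstanceAs (AddCommGroup (L →+ D))

instance (R L D : Type u) [Ring R] [AddCommGroup L] [Module R L] [AddCommGroup D] :
    Module Rᵐᵒᵖ (HomGroup R L D) where
  smul r φ := AddMonoidHom.comp (show L →+ D from φ) (DistribSMul.toAddMonoidHom L (unop r))
  one_smul φ := AddMonoidHom.ext fun l ↦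
    congr_arg (show L →+ D from φ) (one_smul R l)
  mul_smul r s φ := AddMonoidHom.ext fun l ↦
    congr_arg (show L →+ D from φ) (mul_smul (unop s) (unop r) l)
  smul_zero _ := rfl
  smul_add _ _ _ := rfl
  add_smul r s φ := AddMonoidHom.ext fun l ↦
    (congr_arg (show L →+ D from φ) (add_smul (unop r) (unop s) l)).trans
      (map_add (show L →+ D from φ) _ _)
  zero_smul φ := AddMonoidHom.ext fun l ↦
    (congr_arg (show L →+ D from φ) (zero_smul R l)).trans (map_zero (show L →+ D from φ))

/-- The right `R`-module `Hom_ℤ(L, D)`. -/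
abbrev homModule (L : ModuleCat.{u} R) (D : AddCommGrpCat.{u}) : ModuleCat.{u} Rᵐᵒᵖ :=
  ModuleCat.of Rᵐᵒᵖ (HomGroup R L D)

/-- An element of `Hom_ℤ(L, D)` as an additive map. -/
def homModuleEquiv (L : ModuleCat.{u} R) (D : AddCommGrpCat.{u}) : homModule L D ≃+ (L →+ D) :=
  AddEquiv.refl (L →+ D)

/-- The map `Hom_ℤ(ψ, D)`. -/
noncomputable def homModuleMap {L L' : ModuleCat.{u} R} (ψ : L ⟶ L') (D : AddCommGrpCat.{u}) :
    homModule L' D ⟶ homModule L D :=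
  ModuleCat.ofHom
    { toFun φ := (homModuleEquiv L D).symm ((homModuleEquiv L' D φ).comp ψ.hom.toAddMonoidHom)
      map_add' _ _ := rfl
      map_smul' r φ := by
        apply (homModuleEquiv L D).injective
        ext l
        exact congr_arg (homModuleEquiv L' D φ) (map_smul ψ.hom (unop r) l).symm }

lemma exists_extension {D : AddCommGrpCat.{u}} [Injective D] {A B : Type u} [AddCommGroup A]
    [AddCommGroup B] (i : A →+ B) (hi : Function.Injective i) (φ : A →+ D) :
    ∃ ψ : B →+ D, ψ.comp i = φ := by
  have : Mono (AddCommGrpCat.ofHom i) := (AddCommGrpCat.mono_iff_injective _).2 hi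
  refine ⟨(Injective.factorThru (AddCommGrpCat.ofHom φ) (AddCommGrpCat.ofHom i)).hom, ?_⟩
  exact congr_arg AddCommGrpCat.Hom.hom
    (Injective.comp_factorThru (AddCommGrpCat.ofHom φ) (AddCommGrpCat.ofHom i))

/-- Injectivity of `D` gives surjectivity of the last map. The rest is left exactness: an additive
map that vanishes on the image of `E.f` descends along the surjection `E.g`. -/
lemma homModule_shortExact {E : ShortComplex (ModuleCat.{u} R)} (hE : E.ShortExact)
    (D : AddCommGrpCat.{u}) [Injective D] :
    (ShortComplex.mk (homModuleMap E.g D) (homModuleMap E.f D) (by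
      ext φ
      exact AddMonoidHom.ext fun l ↦ (congr_arg (homModuleEquiv _ D φ)
        (ConcreteCategory.congr_hom E.zero l)).trans (map_zero (homModuleEquiv _ D φ)))).ShortExact where
  mono_f := by
    have hg := (ModuleCat.epi_iff_surjective _).1 hE.epi_g
    rw [ModuleCat.mono_iff_injective]
    intro φ ψ h
    apply (homModuleEquiv _ D).injective
    ext l
    obtain ⟨l, rfl⟩ := hg l
    exact DFunLike.congr_fun (congr_arg (homModuleEquiv _ D) h) l
  epi_g := by
    rw [ModuleCat.epi_iff_surjective]
    intro φ
    obtain ⟨ψ, hψ⟩ := exists_extension E.f.hom.toAddMonoidHom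
      ((ModuleCat.mono_iff_injective _).1 hE.mono_f) (homModuleEquiv _ D φ)
    exact ⟨(homModuleEquiv _ D).symm ψ, hψ⟩
  exact := by
    have hg := (ModuleCat.epi_iff_surjective _).1 hE.epi_g
    have he := (ShortComplex.moduleCat_exact_iff _).1 hE.exact
    rw [ShortComplex.moduleCat_exact_iff]
    intro φ hφ
    have hk : E.g.hom.toAddMonoidHom.ker ≤ (homModuleEquiv E.X₂ D φ).ker := by
      intro x hx
      obtain ⟨y, rfl⟩ := he x hx
      exact DFunLike.congr_fun (congr_arg (homModuleEquiv _ D) hφ) y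
    refine ⟨(homModuleEquiv _ D).symm
      (AddMonoidHom.liftOfSurjective E.g.hom.toAddMonoidHom hg ⟨_, hk⟩), ?_⟩
    apply (homModuleEquiv _ D).injective
    ext l
    exact AddMonoidHom.liftOfRightInverse_comp_apply E.g.hom.toAddMonoidHom _
      (Function.rightInverse_surjInv hg) ⟨_, hk⟩ l

/-- By tensor-hom adjunction a map `X ⟶ Hom_ℤ(L, D)` is an additive map `X ⊗_R L → D`. Flatness
makes `X ⊗_R L → Y ⊗_R L` injective, so this map extends to `Y ⊗_R L` by injectivity of `D`. -/
lemma homModule_injective {L : ModuleCat.{u} R} (hL : IsFlat L) (D : AddCommGrpCat.{u})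
    [Injective D] : Injective (homModule L D) where
  factors {X Y} g i hi := by
    obtain ⟨ψ, hψ⟩ := exists_extension _ ((AddCommGrpCat.mono_iff_injective _).1 (hL i hi))
      (balancedLift R (X := X) (M := L)
        ((homModuleEquiv L D).toAddMonoidHom.comp g.hom.toAddMonoidHom) (fun r x m ↦ by
          change homModuleEquiv L D (g.hom (op r • x)) m = _
          rw [map_smul]; rfl))
    refine ⟨ModuleCat.ofHom
      { toFun y := (homModuleEquiv L D).symm (ψ.comp (btmulHom R Y L y))
        map_add' y y' := by
          apply (homModuleEquiv L D).injective
          ext l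
          exact (congr_arg ψ (add_btmul y y' l)).trans (map_add ψ _ _)
        map_smul' r y := by
          apply (homModuleEquiv L D).injective
          ext l
          exact congr_arg ψ (smul_btmul (unop r) y l) }, ?_⟩
    ext x
    apply (homModuleEquiv L D).injective
    ext l
    exact DFunLike.congr_fun hψ (btmul R x l)

/-- If `L` has finite flat dimension and `T` is totally acyclic, then `Hom_ℤ(L, D) ⊗_R T` is
acyclic. -/
lemma homModule_tensor_acyclic {T : CochainComplex (ModuleCat.{u} R) ℤ}
    (hT : IsTotallyAcyclicFlat T) (D : AddCommGrpCat.{u}) [Injective D] (n : ℕ) :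
    ∀ L : ModuleCat.{u} R, HasFlatDimLE n L → (tensorModuleComplex (homModule L D) T).Acyclic := by
  induction n with
  | zero => exact fun L hL ↦ hT.tensor_acyclic _ (homModule_injective hL D)
  | succ n ih =>
    -- `Hom_ℤ(-, D)` reverses the sequence, so `L` now contributes the first term; the middle one is
    -- acyclic since `Hom_ℤ(F, D)` is injective, the last by induction.
    rintro L ⟨K, F, i, p, w, h, hF, hK⟩
    have hF' := hT.tensor_acyclic _ (homModule_injective hF D)
    exact (tensorShortComplex_shortExact (homModule_shortExact h D) hT.flat).acyclic_X₁
      (quasiIso_of_acyclic _ hF' (ih K hK))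

end HomModule

/-! ### Injective right `S`-modules restricted to `R` -/

section Restriction

variable {R S : Type u} [Ring R] [Ring S] (f : R →+* S)

lemma acyclic_of_retract {C : Type*} [Category* C] [Abelian C] {K L : CochainComplex C ℤ}
    (i : K ⟶ L) (r : L ⟶ K) (h : i ≫ r = 𝟙 K) (hL : L.Acyclic) : K.Acyclic := fun n ↦ by
  have := (HomologicalComplex.exactAt_iff_isZero_homology _ _).1 (hL n)
  rw [HomologicalComplex.exactAt_iff_isZero_homology, IsZero.iff_id_eq_zero,
    ← HomologicalComplex.homologyMap_id, ← h, HomologicalComplex.homologyMap_comp,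
    this.eq_zero_of_tgt (HomologicalComplex.homologyMap i n), zero_comp]

/-- The `S`-linear map `x ↦ (s ↦ d (x s))` from a right `S`-module `X` to `Hom_ℤ(S, D)`. -/
noncomputable def toHomModule (X : ModuleCat.{u} Sᵐᵒᵖ) {D : AddCommGrpCat.{u}} (d : X →+ D) :
    X ⟶ homModule (ModuleCat.of S S) D :=
  ModuleCat.ofHom
    { toFun x := (homModuleEquiv (ModuleCat.of S S) D).symm
        (AddMonoidHom.mk' (fun s : S ↦ d (op s • x)) fun s t ↦ by
          exact (congr_arg d (add_smul (op s) (op t) x)).trans (map_add d _ _))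
      map_add' x y := by
        apply (homModuleEquiv _ D).injective
        ext s
        exact (congr_arg d (smul_add (op (show S from s)) x y)).trans (map_add d _ _)
      map_smul' r x := by
        apply (homModuleEquiv _ D).injective
        ext s
        exact congr_arg d (mul_smul (op (show S from s)) r x).symm }

/-- Evaluation at `1 : S` recovers `d x`. -/
lemma toHomModule_injective (X : ModuleCat.{u} Sᵐᵒᵖ) {D : AddCommGrpCat.{u}} (d : X →+ D)
    (hd : Function.Injective d) : Function.Injective (toHomModule X d) := fun x y h ↦ by
  have := DFunLike.congr_fun (congr_arg (homModuleEquiv (ModuleCat.of S S) D) h) (1 : S)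
  refine hd ?_
  have e (z : X) : homModuleEquiv (ModuleCat.of S S) D (toHomModule X d z) (1 : S) = d z :=
    congr_arg d (one_smul _ z)
  rwa [e, e] at this

/-- Restriction of scalars commutes with `Hom_ℤ(-, D)`. -/
noncomputable def homModuleRestrictIso (D : AddCommGrpCat.{u}) :
    (ModuleCat.restrictScalars (RingHom.op f)).obj (homModule (ModuleCat.of S S) D) ≅
      homModule (asLeftModule f) D :=
  let N := (ModuleCat.restrictScalars (RingHom.op f)).obj (homModule (ModuleCat.of S S) D)
  LinearEquiv.toModuleIso (X₁ := N) (g₁ := N.isAddCommGroup) (m₁ := N.isModule)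
    (show N ≃ₗ[Rᵐᵒᵖ] HomGroup R (asLeftModule f) D from
      { AddEquiv.refl (S →+ D) with map_smul' _ _ := rfl })

/-- If `S` has finite flat dimension as a left `R`-module, then `J ⊗_R T` is acyclic for every
injective right `S`-module `J` and every totally acyclic complex `T` of flat `R`-modules. -/
lemma restrict_injective_tensor_acyclic (h : HasFiniteFlatDim (asLeftModule f))
    {T : CochainComplex (ModuleCat.{u} R) ℤ} (hT : IsTotallyAcyclicFlat T)
    (J : ModuleCat.{u} Sᵐᵒᵖ) (hJ : Injective J) :
    (tensorModuleComplex ((ModuleCat.restrictScalars (RingHom.op f)).obj J) T).Acyclic := by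
  obtain ⟨n, hn⟩ := h
  -- Embed the additive group of `J` in an injective group `D`. The resulting `S`-linear embedding
  -- of `J` in `Hom_ℤ(S, D)` splits because `J` is injective over `S`; restricting to `R` keeps the
  -- splitting, and there the flat dimension of `S` as a left `R`-module applies.
  let A := AddCommGrpCat.of J
  let D := Injective.under A
  let d : J →+ D := (Injective.ι A).hom
  have hd : Function.Injective d := (AddCommGrpCat.mono_iff_injective _).1 inferInstance
  have : Mono (toHomModule J d) :=
    (ModuleCat.mono_iff_injective _).2 (toHomModule_injective J d hd)
  let i := (ModuleCat.restrictScalars (RingHom.op f)).map (toHomModule J d) ≫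
    (homModuleRestrictIso f D).hom
  let r := (homModuleRestrictIso f D).inv ≫ (ModuleCat.restrictScalars (RingHom.op f)).map
    (Injective.factorThru (𝟙 J) (toHomModule J d))
  have hir : i ≫ r = 𝟙 _ := by
    simp only [i, r, Category.assoc, Iso.hom_inv_id_assoc]
    rw [← Functor.map_comp, Injective.comp_factorThru, CategoryTheory.Functor.map_id]
  refine acyclic_of_retract
    ((NatTrans.mapHomologicalComplex ((tensorBifunctor R).map i) (ComplexShape.up ℤ)).app T)
    ((NatTrans.mapHomologicalComplex ((tensorBifunctor R).map r) (ComplexShape.up ℤ)).app T)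
    ?_ (homModule_tensor_acyclic hT D n _ hn)
  rw [← NatTrans.comp_app, ← NatTrans.mapHomologicalComplex_comp, ← Functor.map_comp, hir]
  ext1 k
  simp

end Restriction

/-! ### Extension of scalars and the cancellation `X ⊗_S (S ⊗_R M) ≅ X ⊗_R M` -/

section Extension

variable {R S : Type u} [Ring R] [Ring S] (f : R →+* S)

section

variable {M : Type u} [AddCommGroup M] [Module R M]

/-- The class of `s ⊗ m` in `S ⊗_R M`. -/
abbrev etmul (s : S) (m : M) : ExtendScalars f M := Submodule.Quotient.mk (s ⊗ₜ[ℤ] m)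

lemma etmul_add (s : S) (m n : M) : etmul f s (m + n) = etmul f s m + etmul f s n := by
  rw [etmul, TensorProduct.tmul_add]; rfl

lemma add_etmul (s t : S) (m : M) : etmul f (s + t) m = etmul f s m + etmul f t m := by
  rw [etmul, TensorProduct.add_tmul]; rfl

lemma mul_etmul (s : S) (r : R) (m : M) : etmul f (s * f r) m = etmul f s (r • m) :=
  (Submodule.Quotient.eq _).2 (Submodule.subset_span ⟨s, r, m, rfl⟩)

lemma smul_etmul (s t : S) (m : M) : s • etmul f t m = etmul f (s * t) m := rfl

lemma extendScalars_induction {p : ExtendScalars f M → Prop} (h₀ : p 0)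
    (h : ∀ s m, p (etmul f s m)) (h' : ∀ a b, p a → p b → p (a + b)) (t : ExtendScalars f M) :
    p t := by
  obtain ⟨t, rfl⟩ := Submodule.Quotient.mk_surjective _ t
  induction t using TensorProduct.induction_on with
  | zero => exact h₀
  | tmul s m => exact h s m
  | add a b ha hb => exact h' _ _ ha hb

lemma extendScalars_hom_ext {A : Type u} [AddCommGroup A] {g h : ExtendScalars f M →+ A}
    (H : ∀ s m, g (etmul f s m) = h (etmul f s m)) : g = h := by
  ext t
  induction t using extendScalars_induction with
  | h₀ => rw [map_zero, map_zero]
  | h s m => exact H s m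
  | h' a b ha hb => rw [map_add, map_add, ha, hb]

/-- The additive map on `S ⊗_R M` given by a balanced biadditive map. -/
noncomputable def extendLift {A : Type u} [AddCommGroup A] (β : S →+ M →+ A)
    (h : ∀ s r m, β (s * f r) m = β s (r • m)) : ExtendScalars f M →+ A :=
  let γ : S ⊗[ℤ] M →+ A := TensorProduct.liftAddHom (R := ℤ) β fun r s m ↦ by
    rw [map_zsmul, map_zsmul]; rfl
  QuotientAddGroup.lift (extendRel f M).toAddSubgroup γ (by
    intro t (ht : t ∈ extendRel f M)
    -- The relations form an `S`-span while `γ` is only additive. Quantifying over all multiples `s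
    -- • t` lets the span induction pass through scalar multiplication.
    suffices H : ∀ s : S, γ (s • t) = 0 by simpa using H 1
    rw [extendRel] at ht
    induction ht using Submodule.span_induction with
    | mem t ht =>
      obtain ⟨s, r, m, rfl⟩ := ht
      intro a
      rw [smul_sub, map_sub, sub_eq_zero]
      exact (congr_arg (β · m) (mul_assoc a s (f r)).symm).trans (h _ _ _)
    | zero => simp
    | add a b _ _ ha hb => intro s; rw [smul_add, map_add, ha, hb, add_zero]
    | smul a t _ ht => intro s; rw [smul_smul, ht])

end

section

variable (X : ModuleCat.{u} Sᵐᵒᵖ) (M : ModuleCat.{u} R)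

/-- A right `S`-module as a right `R`-module. -/
noncomputable abbrev restrictRight : ModuleCat.{u} Sᵐᵒᵖ ⥤ ModuleCat.{u} Rᵐᵒᵖ :=
  ModuleCat.restrictScalars (RingHom.op f)

/-- The map `s ⊗ m ↦ x s ⊗ m`. -/
noncomputable def tensorExtendAux (x : X) :
    ExtendScalars f M →+ BalancedTensor R ((restrictRight f).obj X) M :=
  extendLift f ((btmulHom R ((restrictRight f).obj X) M).comp
    (AddMonoidHom.mk' (fun s : S ↦ (op s • x : X)) fun s t ↦ add_smul (op s) (op t) x))
    fun s r m ↦ (congr_arg (btmul R (X := (restrictRight f).obj X) · m)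
      (mul_smul (op (f r)) (op s) x)).trans
        (smul_btmul (X := (restrictRight f).obj X) r (op s • x : X) m)

lemma tensorExtendAux_etmul (x : X) (s : S) (m : M) :
    tensorExtendAux f X M x (etmul f s m) =
      btmul R (X := (restrictRight f).obj X) (op s • x : X) m := rfl

/-- The map `x ⊗ (s ⊗ m) ↦ x s ⊗ m`. -/
noncomputable def tensorExtendHom :
    BalancedTensor S X (ExtendScalars f M) →+ BalancedTensor R ((restrictRight f).obj X) M :=
  balancedLift S (AddMonoidHom.mk' (tensorExtendAux f X M) fun x y ↦
      extendScalars_hom_ext f fun s m ↦ by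
        rw [AddMonoidHom.add_apply, tensorExtendAux_etmul, tensorExtendAux_etmul,
          tensorExtendAux_etmul, smul_add]
        exact add_btmul (X := (restrictRight f).obj X) _ _ _)
    fun s x t ↦ by
      change tensorExtendAux f X M (op s • x) t = tensorExtendAux f X M x (s • t)
      induction t using extendScalars_induction with
      | h₀ => rw [smul_zero, map_zero, map_zero]
      | h a m =>
        rw [smul_etmul, tensorExtendAux_etmul, tensorExtendAux_etmul, smul_smul, op_mul]
      | h' a b ha hb => rw [smul_add, map_add, map_add, ha, hb]

lemma tensorExtendHom_btmul (x : X) (s : S) (m : M) :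
    tensorExtendHom f X M (btmul S x (etmul f s m)) =
      btmul R (X := (restrictRight f).obj X) (op s • x : X) m := rfl

/-- The map `x ⊗ m ↦ x ⊗ (1 ⊗ m)`. -/
noncomputable def tensorExtendInv :
    BalancedTensor R ((restrictRight f).obj X) M →+ BalancedTensor S X (ExtendScalars f M) :=
  balancedLift R (X := (restrictRight f).obj X)
    (AddMonoidHom.mk' (fun x ↦ (btmulHom S X (ExtendScalars f M) x).comp
      (AddMonoidHom.mk' (etmul f 1) (etmul_add f 1))) fun x y ↦ by
        ext m
        exact add_btmul (X := X) _ _ _)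
    fun r x m ↦ by
      refine (smul_btmul (X := X) (f r) x (etmul f 1 m)).trans ?_
      -- Writing `f r` as `1 * f r` brings it into the form in which `r` moves across the tensor
      -- sign.
      rw [smul_etmul, mul_one, ← one_mul (f r), mul_etmul]
      rfl

lemma tensorExtendInv_btmul (x : X) (m : M) :
    tensorExtendInv f X M (btmul R (X := (restrictRight f).obj X) x m) =
      btmul S x (etmul f 1 m) := rfl

/-- Two additive maps on `X ⊗_S (S ⊗_R M)` agree if they agree on all `x ⊗ (s ⊗ m)`. -/
lemma tensorExtend_ext {A : Type u} [AddCommGroup A]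
    {g h : BalancedTensor S X (ExtendScalars f M) →+ A}
    (H : ∀ x s m, g (btmul S x (etmul f s m)) = h (btmul S x (etmul f s m))) : g = h :=
  balancedTensor_ext fun x t ↦ DFunLike.congr_fun (extendScalars_hom_ext f (H x) :
    g.comp (btmulHom S X (ExtendScalars f M) x) = h.comp (btmulHom S X (ExtendScalars f M) x)) t

/-- The equivalence `X ⊗_S (S ⊗_R M) ≃ X ⊗_R M`. -/
noncomputable def tensorExtendEquiv :
    BalancedTensor S X (ExtendScalars f M) ≃+ BalancedTensor R ((restrictRight f).obj X) M :=
  AddMonoidHom.toAddEquiv (tensorExtendHom f X M) (tensorExtendInv f X M)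
    (tensorExtend_ext f X M fun x s m ↦ by
      rw [AddMonoidHom.comp_apply, tensorExtendHom_btmul, tensorExtendInv_btmul, smul_btmul,
        smul_etmul, mul_one]; rfl)
    (balancedTensor_ext (X := (restrictRight f).obj X) (M := M) fun x m ↦
      congr_arg (btmul R (X := (restrictRight f).obj X) · m) (one_smul Sᵐᵒᵖ (show X from x)))

/-- The isomorphism `X ⊗_S (S ⊗_R M) ≅ X ⊗_R M`. -/
noncomputable def tensorExtendIso :
    ((tensorBifunctor S).obj X).obj ((extendScalarsFunctor f).obj M) ≅
      ((tensorBifunctor R).obj ((restrictRight f).obj X)).obj M :=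
  AddEquiv.toAddCommGrpIso (tensorExtendEquiv f X M)

variable {X M}

lemma tensorExtendIso_naturality_left {Y : ModuleCat.{u} Sᵐᵒᵖ} (φ : X ⟶ Y) :
    ((tensorBifunctor S).map φ).app ((extendScalarsFunctor f).obj M) ≫
      (tensorExtendIso f Y M).hom = (tensorExtendIso f X M).hom ≫
        ((tensorBifunctor R).map ((restrictRight f).map φ)).app M :=
  AddCommGrpCat.hom_ext (tensorExtend_ext f X M fun x s m ↦
    congr_arg (btmul R (X := (restrictRight f).obj Y) · m) (map_smul φ.hom (op s) x).symm)

lemma tensorExtendIso_naturality_right {N : ModuleCat.{u} R} (ψ : M ⟶ N) :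
    ((tensorBifunctor S).obj X).map ((extendScalarsFunctor f).map ψ) ≫
      (tensorExtendIso f X N).hom = (tensorExtendIso f X M).hom ≫
        ((tensorBifunctor R).obj ((restrictRight f).obj X)).map ψ :=
  AddCommGrpCat.hom_ext (tensorExtend_ext f X M fun _ _ _ ↦ rfl)

end

/-- The underlying abelian group of `S ⊗_R M` is the tensor product of the right `R`-module `S`
with `M`. -/
noncomputable def extendForgetEquiv (M : ModuleCat.{u} R) :
    BalancedTensor R (asRightModule f) M ≃+ ExtendScalars f M :=
  AddMonoidHom.toAddEquiv
    (balancedLift R (X := asRightModule f) (M := M)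
      (AddMonoidHom.mk' (fun s : S ↦ AddMonoidHom.mk' (etmul f s) (etmul_add f s))
        fun s t ↦ AddMonoidHom.ext fun m ↦ add_etmul f s t m)
        fun r s m ↦ mul_etmul f (show S from s) r m)
    (extendLift f (btmulHom R (asRightModule f) M)
      fun s r m ↦ smul_btmul (X := asRightModule f) r (show S from s) m)
    (balancedTensor_ext (X := asRightModule f) (M := M) fun _ _ ↦ rfl)
    (extendScalars_hom_ext f fun _ _ ↦ rfl)

/-- The functor `S ⊗_R -` to abelian groups is given by the right `R`-module `S`. -/
noncomputable def extendForgetIso :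
    tensorLeft (asRightModule f) ≅
      extendScalarsFunctor f ⋙ forget₂ (ModuleCat.{u} S) AddCommGrpCat.{u} :=
  NatIso.ofComponents (fun M ↦ AddEquiv.toAddCommGrpIso
    (X := AddCommGrpCat.of (BalancedTensor R (asRightModule f) M))
    (Y := AddCommGrpCat.of (ExtendScalars f M)) (extendForgetEquiv f M))
    fun {M _} _ ↦ AddCommGrpCat.hom_ext
      (balancedTensor_ext (X := asRightModule f) (M := M) fun _ _ ↦ rfl)

/-- Up to natural isomorphism, `- ⊗_S (S ⊗_R M)` is restriction to `R` followed by `- ⊗_R M`, and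
both preserve monomorphisms. -/
lemma isFlat_extendScalars {M : ModuleCat.{u} R} (hM : IsFlat M) :
    IsFlat ((extendScalarsFunctor f).obj M) := by
  intro X Y φ hφ
  have : Mono ((restrictRight f).map φ) := by
    rw [ModuleCat.mono_iff_injective] at hφ ⊢
    exact hφ
  have := hM _ this
  exact (MorphismProperty.monomorphisms _).arrow_mk_iso_iff
    (Arrow.isoMk (tensorExtendIso f X M) (tensorExtendIso f Y M)
      (tensorExtendIso_naturality_left f φ).symm) |>.2 this

end Extension

/-! ### Extension of scalars for totally acyclic and semi-flat complexes -/

section ExtensionComplexes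

variable {R S : Type u} [Ring R] [Ring S] (f : R →+* S)

/-- The complex `S ⊗_R T`. -/
noncomputable abbrev extendComplex (T : CochainComplex (ModuleCat.{u} R) ℤ) :
    CochainComplex (ModuleCat.{u} S) ℤ :=
  ((extendScalarsFunctor f).mapHomologicalComplex (ComplexShape.up ℤ)).obj T

/-- Exactness can be tested on underlying abelian groups, where `S ⊗_R T` is the tensor product of
`T` with the right `R`-module `S`, and the dimension shift applies. -/
lemma extendComplex_acyclic (h : HasFiniteFlatDim (asRightModule f))
    {T : CochainComplex (ModuleCat.{u} R) ℤ} (hT : ∀ i, IsFlat (T.X i)) (hT' : T.Acyclic) :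
    (extendComplex f T).Acyclic := fun i ↦ by
  obtain ⟨n, hn⟩ := h
  have := tensorModuleComplex_acyclic hT hT' n _ hn i
  refine (ShortComplex.exact_map_iff_of_faithful _
    (forget₂ (ModuleCat.{u} S) AddCommGrpCat.{u})).1 ?_
  exact ShortComplex.exact_of_iso ((T.sc i).mapNatIso (extendForgetIso f)) this

/-- The isomorphism `X ⊗_S (S ⊗_R T) ≅ X ⊗_R T` for a right `S`-module `X`. -/
noncomputable def tensorModuleExtendIso (X : ModuleCat.{u} Sᵐᵒᵖ)
    (T : CochainComplex (ModuleCat.{u} R) ℤ) :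
    tensorModuleComplex X (extendComplex f T) ≅
      tensorModuleComplex ((restrictRight f).obj X) T :=
  HomologicalComplex.Hom.isoOfComponents (fun i ↦ tensorExtendIso f X (T.X i))
    fun i j _ ↦ (tensorExtendIso_naturality_right f (T.d i j)).symm

lemma acyclic_of_iso {C : Type*} [Category* C] [Abelian C] {K L : CochainComplex C ℤ} (e : K ≅ L)
    (hL : L.Acyclic) : K.Acyclic :=
  acyclic_of_retract e.hom e.inv e.hom_inv_id hL

/-- The flat dimension on the right controls acyclicity; the one on the left controls the condition
on injective modules. -/
lemma isTotallyAcyclicFlat_extendComplex (hleft : HasFiniteFlatDim (asLeftModule f))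
    (hright : HasFiniteFlatDim (asRightModule f)) {T : CochainComplex (ModuleCat.{u} R) ℤ}
    (hT : IsTotallyAcyclicFlat T) : IsTotallyAcyclicFlat (extendComplex f T) where
  flat i := isFlat_extendScalars f (hT.flat i)
  acyclic := extendComplex_acyclic f hright hT.flat hT.acyclic
  tensor_acyclic J hJ := acyclic_of_iso (tensorModuleExtendIso f J T)
    (restrict_injective_tensor_acyclic f hleft hT J hJ)

/-- The bicomplexes underlying `X ⊗_S (S ⊗_R F)` and `X ⊗_R F` are isomorphic. -/
noncomputable def tensorBicomplexExtendIso (X : CochainComplex (ModuleCat.{u} Sᵐᵒᵖ) ℤ)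
    (F : CochainComplex (ModuleCat.{u} R) ℤ) :
    (((tensorBifunctor S).mapBifunctorHomologicalComplex (ComplexShape.up ℤ)
      (ComplexShape.up ℤ)).obj X).obj (extendComplex f F) ≅
    (((tensorBifunctor R).mapBifunctorHomologicalComplex (ComplexShape.up ℤ)
      (ComplexShape.up ℤ)).obj
        (((restrictRight f).mapHomologicalComplex (ComplexShape.up ℤ)).obj X)).obj F :=
  HomologicalComplex.Hom.isoOfComponents
    (fun i ↦ HomologicalComplex.Hom.isoOfComponents (fun j ↦ tensorExtendIso f (X.X i) (F.X j))
      fun j k _ ↦ (tensorExtendIso_naturality_right f (F.d j k)).symm)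
    fun i j _ ↦ by
      ext k : 1
      exact (tensorExtendIso_naturality_left f (X.d i j)).symm

lemma quasiIso_tensorComplexMap_extendComplex {F : CochainComplex (ModuleCat.{u} R) ℤ}
    {X Y : CochainComplex (ModuleCat.{u} Sᵐᵒᵖ) ℤ} (φ : X ⟶ Y)
    (h : QuasiIso (tensorComplexMap
      (((restrictRight f).mapHomologicalComplex (ComplexShape.up ℤ)).map φ) F)) :
    QuasiIso (tensorComplexMap φ (extendComplex f F)) := by
  refine (quasiIso_iff_of_arrow_mk_iso _ _ (Arrow.isoMk
    (HomologicalComplex₂.total.mapIso (tensorBicomplexExtendIso f X F) (ComplexShape.up ℤ))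
    (HomologicalComplex₂.total.mapIso (tensorBicomplexExtendIso f Y F) (ComplexShape.up ℤ)) ?_)).2 h
  refine (HomologicalComplex₂.total.map_comp _ _ _).symm.trans
    (Eq.trans ?_ (HomologicalComplex₂.total.map_comp _ _ _))
  congr 1
  -- The maps are the identity in the second variable; once that factor is removed, naturality in
  -- `X` remains.
  rw [CategoryTheory.Functor.map_id, CategoryTheory.Functor.map_id, Category.comp_id,
    Category.comp_id]
  ext i k : 2
  exact (tensorExtendIso_naturality_left f (φ.f i)).symm

/-- Restriction of scalars is exact, so it preserves the quasi-isomorphisms to be tested. -/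
lemma isSemiFlat_extendComplex {F : CochainComplex (ModuleCat.{u} R) ℤ} (hF : IsSemiFlat F) :
    IsSemiFlat (extendComplex f F) where
  flat i := isFlat_extendScalars f (hF.flat i)
  quasiIso φ hφ := by
    have := restrictScalars_preservesHomology (RingHom.op f)
    exact quasiIso_tensorComplexMap_extendComplex f φ (hF.quasiIso _ inferInstance)

end ExtensionComplexes

/-! ### Comparison with the derived tensor product -/

section DerivedInvariance

/-- In the homotopy category the quasi-isomorphisms are the morphisms whose cone lies in the acyclic
subcategory. -/
lemma quasiIso_iff_mappingCone_acyclic {C : Type*} [Category* C] [Abelian C]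
    {K L : CochainComplex C ℤ} (φ : K ⟶ L) :
    QuasiIso φ ↔ (CochainComplex.mappingCone φ).Acyclic := by
  rw [← HomotopyCategory.quotient_obj_mem_subcategoryAcyclic_iff_acyclic,
    ← HomologicalComplex.mem_quasiIso_iff, ← HomotopyCategory.quotient_map_mem_quasiIso_iff,
    HomotopyCategory.quasiIso_eq_trW_subcategoryAcyclic]
  exact ObjectProperty.trW_iff_of_distinguished _ _
    (HomotopyCategory.mappingCone_triangleh_distinguished φ)

lemma DerivedIso.of_quasiIso {R : Type u} [Ring R] {K L : CochainComplex (ModuleCat.{u} R) ℤ}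
    (φ : K ⟶ L) (hφ : QuasiIso φ) : DerivedIso K L := by
  let := HasDerivedCategory.standard (ModuleCat.{u} R)
  exact ⟨asIso (DerivedCategory.Q.map φ)⟩

lemma DerivedIso.symm {R : Type u} [Ring R] {K L : CochainComplex (ModuleCat.{u} R) ℤ}
    (h : DerivedIso K L) : DerivedIso L K := by
  let := HasDerivedCategory.standard (ModuleCat.{u} R)
  obtain ⟨e⟩ := h
  exact ⟨e.symm⟩

lemma DerivedIso.trans {R : Type u} [Ring R] {K L N : CochainComplex (ModuleCat.{u} R) ℤ}
    (h : DerivedIso K L) (h' : DerivedIso L N) : DerivedIso K N := by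
  let := HasDerivedCategory.standard (ModuleCat.{u} R)
  obtain ⟨e⟩ := h
  obtain ⟨e'⟩ := h'
  exact ⟨e.trans e'⟩

/-- Morphisms out of a K-projective complex in the derived category are homotopy classes of chain
maps. The given isomorphism thus comes from a chain map, which is a quasi-isomorphism because it
becomes invertible. -/
lemma DerivedIso.exists_quasiIso {R : Type u} [Ring R]
    {P F : CochainComplex (ModuleCat.{u} R) ℤ} [P.IsKProjective] (h : DerivedIso P F) :
    ∃ φ : P ⟶ F, QuasiIso φ := by
  let := HasDerivedCategory.standard (ModuleCat.{u} R)
  obtain ⟨e⟩ := h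
  obtain ⟨g, hg⟩ := (CochainComplex.IsKProjective.Qh_map_bijective P
    ((HomotopyCategory.quotient _ _).obj F)).surjective
    ((DerivedCategory.quotientCompQhIso _).hom.app P ≫ e.hom ≫
      (DerivedCategory.quotientCompQhIso _).inv.app F)
  obtain ⟨φ, rfl⟩ := (HomotopyCategory.quotient _ _).map_surjective g
  refine ⟨φ, ?_⟩
  rw [← DerivedCategory.isIso_Q_map_iff_quasiIso,
    ← NatIso.isIso_map_iff (DerivedCategory.quotientCompQhIso _) φ, Functor.comp_map, hg]
  infer_instance

variable {R S : Type u} [Ring R] [Ring S] (f : R →+* S)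

/-- The functor `S ⊗_R -` preserves quasi-isomorphisms between complexes of flat modules, if `S`
has finite flat dimension as a right `R`-module. -/
lemma quasiIso_extendComplex (h : HasFiniteFlatDim (asRightModule f))
    {K L : CochainComplex (ModuleCat.{u} R) ℤ} (hK : ∀ i, IsFlat (K.X i))
    (hL : ∀ i, IsFlat (L.X i)) (φ : K ⟶ L) (hφ : QuasiIso φ) :
    QuasiIso (((extendScalarsFunctor f).mapHomologicalComplex (ComplexShape.up ℤ)).map φ) := by
  -- Additive functors commute with mapping cones, so it suffices that `S ⊗_R -` keeps the cone of
  -- `φ`, an acyclic complex of flat modules, acyclic.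
  rw [quasiIso_iff_mappingCone_acyclic] at hφ ⊢
  refine acyclic_of_iso (CochainComplex.mappingCone.mapHomologicalComplexIso φ _).symm
    (extendComplex_acyclic f h (fun i ↦ ?_) hφ)
  exact isFlat_of_iso (HomologicalComplex.homotopyCofiber.XIsoBiprod φ i (i + 1) rfl).symm
    (isFlat_biprod (hK _) (hL _))

lemma derivedIso_extendComplex (h : HasFiniteFlatDim (asRightModule f))
    {M F : CochainComplex (ModuleCat.{u} R) ℤ} (hF : ∀ i, IsFlat (F.X i)) (hFM : DerivedIso F M) :
    DerivedIso (extendComplex f F) (derivedExtendScalars f M) := by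
  -- This is the very choice behind `semiProjectiveResolution`, so `S ⊗_R P` is
  -- `derivedExtendScalars f M` by definition.
  obtain ⟨π, hP, hπ⟩ := (exists_semiProjective_resolution M).choose_spec
  have := hP.isKProjective
  obtain ⟨φ, hφ⟩ := ((DerivedIso.of_quasiIso π hπ).trans hFM.symm).exists_quasiIso
  exact (DerivedIso.of_quasiIso _ (quasiIso_extendComplex f h
    (fun i ↦ isFlat_of_projective (hP.projective i)) hF φ hφ)).symm

/-- Extension of scalars of a Tate flat resolution. -/
lemma isTateFlatResolution_extendComplex (hleft : HasFiniteFlatDim (asLeftModule f))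
    (hright : HasFiniteFlatDim (asRightModule f)) {M T F : CochainComplex (ModuleCat.{u} R) ℤ}
    {g : ℤ} (h : IsTateFlatResolution M T F g) :
    IsTateFlatResolution (derivedExtendScalars f M) (extendComplex f T) (extendComplex f F) g where
  totallyAcyclic := isTotallyAcyclicFlat_extendComplex f hleft hright h.totallyAcyclic
  semiFlat := isSemiFlat_extendComplex f h.semiFlat
  derivedIso := derivedIso_extendComplex f hright h.semiFlat.flat h.derivedIso
  -- Truncation only reindexes the terms, so it commutes definitionally with a functor applied
  -- degreewise.
  truncIso := h.truncIso.map
    ((extendScalarsFunctor f).mapHomologicalComplex (ComplexShape.down ℕ)).mapIso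

end DerivedInvariance

end GorFlat

theorem mainTheorem9 {R S : Type u} [Ring R] [Ring S] (f : R →+* S)
    (hleft : GorFlat.HasFiniteFlatDim (GorFlat.asLeftModule f))
    (hright : GorFlat.HasFiniteFlatDim (GorFlat.asRightModule f))
    (M : CochainComplex (ModuleCat.{u} R) ℤ) :
    GorFlat.gfd (GorFlat.derivedExtendScalars f M) ≤ GorFlat.gfd M := by
  -- Every `g` admissible for `M` is admissible for `S ⊗^L_R M`.
  refine sInf_le_sInf ?_
  rintro _ ⟨g, rfl, T, F, h⟩
  exact ⟨g, rfl, _, _, GorFlat.isTateFlatResolution_extendComplex f hleft hright h⟩
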